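/- Call a set $\Omega\subset\mathbb R^2$ regular if it is bounded and open with boundary of class $C^\infty$ (near each boundary point, in suitable Cartesian coordinates, $\Omega$ is the strict subgraph of a smooth function). Let $P(\Omega)=\sup\{\int_\Omega \operatorname{div}T\,dx : T\in C_c^1(\mathbb R^2;\mathbb R^2),\ |T|\le 1\}$ be the perimeter, let $\kappa$ be the curvature of $\partial\Omega$, and for $\lambda,\alpha>0$ set $$F_{\lambda,\alpha}(\Omega)=P(\Omega)-\frac{\lambda^2}{4\pi}\int_\Omega\int_{\Omega^c}\frac{e^{-\lambda\alpha|x-y|}}{|x-y|}\,dy\,dx .$$ Let $\alpha>0$ and let $\Omega$ be a regular set. Then $P(\Omega)$, the double integral (for every $\lambda>0$) and $\int_{\partial\Omega}\kappa^2\,d\mathcal H^1$ are finite, and, as $\lambda\to\infty$, $$F_{\lambda,\alpha}(\Omega)=\Big(1-\frac{1}{2\pi\alpha^2}\Big)P(\Omega)+\frac{1}{8\pi\alpha^4\lambda^2}\int_{\partial\Omega}\kappa^2\,d\mathcal H^1+o(\lambda^{-2}).$$ -/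

import Mathlib

open MeasureTheory Filter Topology Asymptotics
open scoped ContDiff ENNReal

noncomputable section

/-- The Euclidean plane. -/
abbrev Plane : Type := EuclideanSpace ℝ (Fin 2)

/-- A regular set: a bounded open set with boundary of class `C^∞`, i.e. near each boundary point,
in suitable Cartesian coordinates, the set is the strict subgraph of a smooth function (in
particular it lies on one side of its boundary). -/
structure IsRegularSet (Ω : Set Plane) : Prop where
  isOpen : IsOpen Ω
  isBounded : Bornology.IsBounded Ω
  smooth_boundary : ∀ x ∈ frontier Ω, ∃ r : ℝ, 0 < r ∧ ∃ (e : Plane ≃ₗᵢ[ℝ] Plane) (f : ℝ → ℝ),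
    ContDiff ℝ ∞ f ∧
      ∀ y ∈ Metric.ball x r, (y ∈ Ω ↔ (e y) 1 < f ((e y) 0))

/-- The divergence of a vector field on the plane. -/
def planeDiv (T : Plane → Plane) (x : Plane) : ℝ :=
  ∑ i : Fin 2, (fderiv ℝ T x (EuclideanSpace.single i 1)) i

/-- The (De Giorgi) perimeter of a subset of the plane:
the supremum of `∫_Ω div T` over all `T ∈ C_c^1(ℝ², ℝ²)` with `|T| ≤ 1`. -/
def perimeter (Ω : Set Plane) : ℝ≥0∞ :=
  ⨆ (T : Plane → Plane) (_ : ContDiff ℝ 1 T ∧ HasCompactSupport T ∧ ∀ x, ‖T x‖ ≤ 1),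
    ENNReal.ofReal (∫ x in Ω, planeDiv T x)

/-- The screened kernel `e^{-a|z|} / |z|`. -/
def yukawa (a : ℝ) (z : Plane) : ℝ := Real.exp (-(a * ‖z‖)) / ‖z‖

/-- The energy `F_{λ,α}(Ω)`, with `l` in the role of `λ`. -/
def energy (l α : ℝ) (Ω : Set Plane) : ℝ :=
  (perimeter Ω).toReal -
    l ^ 2 / (4 * Real.pi) * ∫ x in Ω, ∫ y in Ωᶜ, yukawa (l * α) (x - y)

/-- Counterclockwise rotation by a right angle, `(v₁, v₂)^⊥ = (-v₂, v₁)`. -/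
def perp (v : Plane) : Plane := !₂[-v 1, v 0]

/-- `k` is the (signed) curvature of `∂Ω` at `x`: it is `(γ')^⊥ · γ'' / |γ'|³` at `t = 0` for some
regular curve `γ` running in `∂Ω`, with `γ 0 = x`, oriented so that `-(γ')^⊥` points
out of `Ω` (so `k > 0` for a disk). -/
def HasBoundaryCurvature (Ω : Set Plane) (x : Plane) (k : ℝ) : Prop :=
  ∃ γ : ℝ → Plane, ContDiffAt ℝ 2 γ 0 ∧ γ 0 = x ∧ deriv γ 0 ≠ 0 ∧
    (∀ᶠ t in 𝓝 (0 : ℝ), γ t ∈ frontier Ω) ∧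
    (∀ᶠ s in 𝓝[>] (0 : ℝ), x + s • perp (deriv γ 0) ∈ Ω) ∧
    k = inner ℝ (perp (deriv γ 0)) (deriv (deriv γ) 0) / ‖deriv γ 0‖ ^ 3

open Classical in
/-- The curvature `κ` of `∂Ω`. At every boundary point of a regular set there is exactly one `k`
with `HasBoundaryCurvature Ω x k`; where there is none the value is `0`. -/
def curvature (Ω : Set Plane) (x : Plane) : ℝ :=
  if h : ∃ k, HasBoundaryCurvature Ω x k then h.choose else 0

end

/-!
Put `a = λα`. Away from the origin, `e^{-a|z|}/|z|` is the divergence of a radial field decaying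
exponentially, so for `x ∈ Ω` the integral of the kernel over `Ωᶜ` is a flux through `∂Ω`.
Exchanging the two integrals leaves, at each `y ∈ ∂Ω`, the integral over `Ω` of a flux kernel. For
a half-plane this equals `2 / a ^ 2` exactly, which yields the perimeter term. What remains is the
defect between `Ω` and its tangent half-plane at `y`. The boundary lies between two parabolas
tangent at `y`, with opening uniform in `y`, so the rescaling `(s, t) ↦ (s / a, t / a ^ 2)` of
tangent and normal coordinates shows, by dominated convergence, that `a ^ 4` times the defect tends
to `κ(y) ^ 2 / 2`, boundedly in `y`.
-/

/-! ### Cartesian coordinates and the divergence -/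

/-- The linear coordinates `(s, t) ↦ e⁻¹ (s, t)` on the plane attached to a linear isometry `e`.
The source is `ℝ × ℝ` rather than `Plane`, so that Fubini's theorem applies directly. -/
noncomputable def planeCoord (e : Plane ≃ₗᵢ[ℝ] Plane) : (ℝ × ℝ) ≃L[ℝ] Plane :=
  (ContinuousLinearEquiv.finTwoArrow ℝ ℝ).symm.trans
    ((PiLp.continuousLinearEquiv 2 ℝ fun _ : Fin 2 => ℝ).symm.trans
      e.symm.toContinuousLinearEquiv)

section Coordinates

variable (e : Plane ≃ₗᵢ[ℝ] Plane)

lemma planeCoord_apply (p : ℝ × ℝ) : planeCoord e p = e.symm !₂[p.1, p.2] := rfl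

@[simp] lemma apply_planeCoord_zero (p : ℝ × ℝ) : (e (planeCoord e p)) 0 = p.1 := by
  simp [planeCoord_apply]

@[simp] lemma apply_planeCoord_one (p : ℝ × ℝ) : (e (planeCoord e p)) 1 = p.2 := by
  simp [planeCoord_apply]

@[simp] lemma planeCoord_coords (y : Plane) : planeCoord e ((e y) 0, (e y) 1) = y := by
  rw [planeCoord_apply, LinearIsometryEquiv.symm_apply_eq]
  ext i
  fin_cases i <;> simp

lemma norm_planeCoord (p : ℝ × ℝ) : ‖planeCoord e p‖ = √(p.1 ^ 2 + p.2 ^ 2) := by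
  simp [planeCoord_apply, EuclideanSpace.norm_eq]

lemma norm_sq_eq_coords (z : Plane) : ‖z‖ ^ 2 = (e z) 0 ^ 2 + (e z) 1 ^ 2 := by
  rw [← e.norm_map z, EuclideanSpace.real_norm_sq_eq, Fin.sum_univ_two]

lemma abs_coord_le_norm (z : Plane) (i : Fin 2) : |(e z) i| ≤ ‖z‖ := by
  rw [← e.norm_map z]
  exact PiLp.norm_apply_le (e z) i

lemma contDiff_coord (i : Fin 2) {n : WithTop ℕ∞} : ContDiff ℝ n fun y => (e y) i :=
  (contDiff_piLp_apply (p := 2) (i := i)).comp e.contDiff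

lemma measurePreserving_planeCoord : MeasurePreserving (planeCoord e) :=
  e.symm.measurePreserving.comp
    ((PiLp.volume_preserving_toLp (Fin 2)).comp (volume_preserving_finTwoArrow ℝ).symm)

lemma measurableEmbedding_planeCoord : MeasurableEmbedding (planeCoord e) :=
  (planeCoord e).toHomeomorph.measurableEmbedding

lemma inner_plane (x y : Plane) : inner ℝ x y = x 0 * y 0 + x 1 * y 1 := by
  simp [PiLp.inner_apply, Fin.sum_univ_two, mul_comm]

lemma inner_planeCoord (p : ℝ × ℝ) (z : Plane) :
    inner ℝ (planeCoord e p) z = p.1 * (e z) 0 + p.2 * (e z) 1 := by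
  rw [← LinearIsometryEquiv.inner_map_map e, inner_plane, apply_planeCoord_zero,
    apply_planeCoord_one]

end Coordinates

lemma exists_isometry_apply_one_eq_inner {n : Plane} (hn : ‖n‖ = 1) :
    ∃ e : Plane ≃ₗᵢ[ℝ] Plane, ∀ z, (e z) 1 = inner ℝ n z := by
  set w : Plane := EuclideanSpace.single 1 1
  have hw : ‖w‖ = 1 := by simp [w]
  have hreflection : (ℝ ∙ (n - w))ᗮ.reflection n = w :=
    Submodule.reflection_sub (hn.trans hw.symm)
  refine ⟨(ℝ ∙ (n - w))ᗮ.reflection, fun z => ?_⟩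
  rw [← LinearIsometryEquiv.inner_map_map ((ℝ ∙ (n - w))ᗮ.reflection) n z, hreflection,
    inner_plane]
  simp [w]

lemma continuous_fderiv_apply_const {E F : Type*} [NormedAddCommGroup E] [NormedSpace ℝ E]
    [NormedAddCommGroup F] [NormedSpace ℝ F] {G : E → F} (hG : ContDiff ℝ 1 G) (v : E) :
    Continuous fun p => fderiv ℝ G p v :=
  (hG.continuous_fderiv one_ne_zero).clm_apply continuous_const

lemma planeDiv_eq_trace (T : Plane → Plane) (x : Plane) :
    planeDiv T x = LinearMap.trace ℝ Plane (fderiv ℝ T x : Plane →ₗ[ℝ] Plane) := by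
  rw [LinearMap.trace_eq_sum_inner _ (EuclideanSpace.basisFun (Fin 2) ℝ)]
  simp [planeDiv, inner_plane]

lemma planeDiv_eq_isometry (e : Plane ≃ₗᵢ[ℝ] Plane) (T : Plane → Plane) (x : Plane) :
    planeDiv T x = (e (fderiv ℝ T x (planeCoord e (1, 0)))) 0 +
      (e (fderiv ℝ T x (planeCoord e (0, 1)))) 1 := by
  have h0 : planeCoord e (1, 0) = e.symm (EuclideanSpace.single 0 1) := by
    rw [planeCoord_apply]
    congr 1
    ext i
    fin_cases i <;> simp
  have h1 : planeCoord e (0, 1) = e.symm (EuclideanSpace.single 1 1) := by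
    rw [planeCoord_apply]
    congr 1
    ext i
    fin_cases i <;> simp
  rw [planeDiv_eq_trace, LinearMap.trace_eq_sum_inner _
    ((EuclideanSpace.basisFun (Fin 2) ℝ).map e.symm), Fin.sum_univ_two]
  simp only [OrthonormalBasis.map_apply, EuclideanSpace.basisFun_apply,
    ← h0, ← h1, inner_planeCoord, ContinuousLinearMap.coe_coe]
  ring

lemma planeDiv_add {S T : Plane → Plane} {x : Plane} (hS : DifferentiableAt ℝ S x)
    (hT : DifferentiableAt ℝ T x) : planeDiv (S + T) x = planeDiv S x + planeDiv T x := by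
  simp [planeDiv, fderiv_add hS hT, Finset.sum_add_distrib]

lemma planeDiv_sum {ι : Type*} (s : Finset ι) {T : ι → Plane → Plane} {x : Plane}
    (hT : ∀ i, DifferentiableAt ℝ (T i) x) :
    planeDiv (fun z => ∑ i ∈ s, T i z) x = ∑ i ∈ s, planeDiv (T i) x := by
  simp only [planeDiv, fderiv_fun_sum fun i _ => hT i]
  rw [Finset.sum_comm]
  simp

lemma planeDiv_of_notMem_tsupport {T : Plane → Plane} {x : Plane} (hx : x ∉ tsupport T) :
    planeDiv T x = 0 := by
  simp [planeDiv, fderiv_of_notMem_tsupport ℝ hx]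

lemma continuous_planeDiv {T : Plane → Plane} (hT : ContDiff ℝ 1 T) :
    Continuous (planeDiv T) :=
  continuous_finsetSum _ fun i _ =>
    (EuclideanSpace.proj (𝕜 := ℝ) i).continuous.comp (continuous_fderiv_apply_const hT _)

lemma integrable_planeDiv {T : Plane → Plane} {μ : Measure Plane}
    (hd : ∀ v, Integrable (fun x => fderiv ℝ T x v) μ) : Integrable (planeDiv T) μ :=
  integrable_finsetSum _ fun i _ =>
    (EuclideanSpace.proj (𝕜 := ℝ) i : Plane →L[ℝ] ℝ).integrable_comp (hd _)

lemma integral_planeDiv_eq_zero {T : Plane → Plane} (hT : Differentiable ℝ T)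
    (hi : Integrable T) (hd : ∀ v, Integrable fun x => fderiv ℝ T x v) :
    ∫ x, planeDiv T x = 0 := by
  have hderiv : ∀ v, ∫ x, fderiv ℝ T x v = 0 := fun v => by
    simpa using integral_smul_fderiv_eq_neg_fderiv_smul_of_integrable (μ := volume)
      (f := fun _ : Plane => (1 : ℝ)) (g := T) (v := v) (by simp) (by simpa using hd v)
      (by simpa using hi) (fun x _ => differentiableAt_const _) (fun x _ => hT x)
  have hcoord : ∀ (i : Fin 2) v, ∫ x, (fderiv ℝ T x v) i = 0 := fun i v => by
    have h := (EuclideanSpace.proj (𝕜 := ℝ) i : Plane →L[ℝ] ℝ).integral_comp_comm (hd v)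
    rwa [hderiv, map_zero] at h
  calc ∫ x, planeDiv T x
      = ∑ i : Fin 2, ∫ x, (fderiv ℝ T x (EuclideanSpace.single i 1)) i :=
        integral_finsetSum _ fun i _ =>
          (EuclideanSpace.proj (𝕜 := ℝ) i : Plane →L[ℝ] ℝ).integrable_comp (hd _)
    _ = 0 := Finset.sum_eq_zero fun i _ => hcoord i _

/-! ### The area formula for curves -/

section AreaFormula

open scoped NNReal

lemma measure_le_of_forall_one_lt_smul {X : Type*} [MeasurableSpace X] {μ ν : Measure X}
    (h : ∀ r : ℝ≥0, 1 < r → μ ≤ r • ν) : μ ≤ ν := by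
  refine Measure.le_iff.2 fun A _ => ?_
  have hlim : Tendsto (fun r : ℝ≥0 => (r : ℝ≥0∞) * ν A) (𝓝[>] 1) (𝓝 (1 * ν A)) :=
    ENNReal.Tendsto.mul_const
      (ENNReal.continuous_coe.continuousWithinAt (s := Set.Ioi 1) (x := (1 : ℝ≥0)))
      (Or.inl one_ne_zero)
  rw [one_mul] at hlim
  exact ge_of_tendsto hlim (eventually_mem_nhdsWithin.mono fun r hr => h r hr A)

lemma measure_le_of_locally_restrict_le {X : Type*} [TopologicalSpace X]
    [SecondCountableTopology X] [MeasurableSpace X] [OpensMeasurableSpace X] {μ ν : Measure X}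
    (h : ∀ x, ∃ U ∈ 𝓝 x, μ.restrict U ≤ ν.restrict U) : μ ≤ ν := by
  choose U hU hle using h
  obtain ⟨t, htc, ht⟩ :=
    TopologicalSpace.countable_cover_nhds fun x => interior_mem_nhds.2 (hU x)
  rcases t.eq_empty_or_nonempty with rfl | htne
  · have : IsEmpty X := Set.univ_eq_empty_iff.1 (by simpa using ht.symm)
    exact (Measure.eq_zero_of_isEmpty μ).trans_le (Measure.zero_le ν)
  obtain ⟨u, rfl⟩ := htc.exists_eq_range htne
  set V : ℕ → Set X := fun n => interior (U (u n))
  have hV : ∀ n, MeasurableSet (disjointed V n) :=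
    MeasurableSet.disjointed fun n => isOpen_interior.measurableSet
  have hVU : ∀ n, disjointed V n ⊆ U (u n) := fun n =>
    (disjointed_subset V n).trans interior_subset
  refine Measure.le_iff.2 fun A hA => ?_
  have hunion : ⋃ n, A ∩ disjointed V n = A := by
    rw [← Set.inter_iUnion, iUnion_disjointed, show ⋃ n, V n = Set.univ by simpa [V] using ht,
      Set.inter_univ]
  have hdisj : Pairwise (Function.onFun Disjoint fun n => A ∩ disjointed V n) := fun i j hij =>
    (disjoint_disjointed V hij).mono Set.inter_subset_right Set.inter_subset_right
  rw [← hunion, measure_iUnion hdisj fun n => hA.inter (hV n),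
    measure_iUnion hdisj fun n => hA.inter (hV n)]
  refine ENNReal.tsum_le_tsum fun n => ?_
  have hsub : A ∩ disjointed V n ⊆ U (u n) := Set.inter_subset_right.trans (hVU n)
  rw [← Measure.restrict_eq_self μ hsub, ← Measure.restrict_eq_self ν hsub]
  exact hle (u n) _

lemma hausdorffMeasure_le_of_antilipschitz_domRestrict {X Y : Type*} [EMetricSpace X]
    [EMetricSpace Y] [MeasurableSpace X] [BorelSpace X] [MeasurableSpace Y] [BorelSpace Y]
    {f : X → Y} {s : Set X} {K : ℝ≥0} {d : ℝ} (hf : AntilipschitzWith K (s.domRestrict f))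
    (hd : 0 ≤ d) : μH[d] s ≤ (K : ℝ≥0∞) ^ d * μH[d] (f '' s) := by
  have h := hf.le_hausdorffMeasure_image hd Set.univ
  rwa [← isometry_subtype_coe.hausdorffMeasure_image (Or.inl hd), Set.image_univ,
    Subtype.range_coe, Set.image_univ, Set.range_domRestrict] at h

lemma hausdorffMeasure_image_bounds {Y : Type*} [MetricSpace Y] [MeasurableSpace Y]
    [BorelSpace Y] {g : ℝ → Y} {U A : Set ℝ} {L M : ℝ≥0}
    (h : ∀ s ∈ U, ∀ t ∈ U, L * dist s t ≤ dist (g s) (g t) ∧ dist (g s) (g t) ≤ M * dist s t)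
    (hA : A ⊆ U) : L * volume A ≤ μH[1] (g '' A) ∧ μH[1] (g '' A) ≤ M * volume A := by
  constructor
  · rcases eq_or_ne L 0 with rfl | hL
    · simp
    have hL0 : (0 : ℝ) < L := NNReal.coe_pos.2 (pos_iff_ne_zero.2 hL)
    have hanti : AntilipschitzWith L⁻¹ (A.domRestrict g) :=
      AntilipschitzWith.of_le_mul_dist fun s t => by
        rw [NNReal.coe_inv, ← div_eq_inv_mul, le_div_iff₀' hL0]
        exact (h s (hA s.2) t (hA t.2)).1
    have hle := hausdorffMeasure_le_of_antilipschitz_domRestrict hanti zero_le_one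
    rwa [ENNReal.rpow_one, hausdorffMeasure_real, ENNReal.coe_inv hL, mul_comm, ← div_eq_mul_inv,
      ENNReal.le_div_iff_mul_le (by simp [hL]) (by simp), mul_comm] at hle
  · have hlip : LipschitzOnWith M g A :=
      LipschitzOnWith.of_dist_le_mul fun s hs t ht => (h s (hA hs) t (hA ht)).2
    simpa [hausdorffMeasure_real] using hlip.hausdorffMeasure_image_le zero_le_one

lemma setLIntegral_enorm_bounds {X F : Type*} [MeasurableSpace X] {μ : Measure X}
    [NormedAddCommGroup F] {h : X → F} {A : Set X} {L M : ℝ≥0} (hA : MeasurableSet A)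
    (hLM : ∀ t ∈ A, L ≤ ‖h t‖₊ ∧ ‖h t‖₊ ≤ M) :
    L * μ A ≤ ∫⁻ t in A, ‖h t‖ₑ ∂μ ∧ ∫⁻ t in A, ‖h t‖ₑ ∂μ ≤ M * μ A := by
  rw [← setLIntegral_const, ← setLIntegral_const]
  exact ⟨setLIntegral_mono' hA fun t ht => ENNReal.coe_le_coe.2 (hLM t ht).1,
    setLIntegral_mono' hA fun t ht => ENNReal.coe_le_coe.2 (hLM t ht).2⟩

variable {E : Type*} [NormedAddCommGroup E] [NormedSpace ℝ E]

lemma exists_nhds_bilipschitz {g : ℝ → E} {g' : E} {t₀ : ℝ} (hg : HasStrictDerivAt g g' t₀)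
    {L M : ℝ≥0} (hL : L < ‖g'‖₊) (hM : ‖g'‖₊ < M) :
    ∃ U ∈ 𝓝 t₀, ∀ s ∈ U, ∀ t ∈ U, L * dist s t ≤ dist (g s) (g t) ∧
      dist (g s) (g t) ≤ M * dist s t := by
  have hL' : (0 : ℝ) < ‖g'‖ - L := sub_pos.2 hL
  have hM' : (0 : ℝ) < M - ‖g'‖ := sub_pos.2 hM
  set η : ℝ := min (‖g'‖ - L) (M - ‖g'‖)
  have hlin : ∀ᶠ p in 𝓝 (t₀, t₀), ‖g p.1 - g p.2 - (p.1 - p.2) • g'‖ ≤ η * ‖p.1 - p.2‖ :=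
    hg.isLittleO.def (lt_min hL' hM')
  rw [nhds_prod_eq] at hlin
  obtain ⟨U, hU, hUlin⟩ := eventually_prod_self_iff'.1 hlin
  refine ⟨U, hU, fun s hs t ht => ?_⟩
  have habs := abs_le.1 ((abs_norm_sub_norm_le _ _).trans (hUlin s hs t ht))
  rw [norm_smul, ← dist_eq_norm, ← dist_eq_norm] at habs
  have hηL : η * dist s t ≤ (‖g'‖ - L) * dist s t := by gcongr; exact min_le_left _ _
  have hηM : η * dist s t ≤ (M - ‖g'‖) * dist s t := by gcongr; exact min_le_right _ _
  constructor <;> nlinarith [habs.1, habs.2]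

variable [MeasurableSpace E] [BorelSpace E]

lemma exists_nhds_comap_hausdorffMeasure_comparable {g : ℝ → E} (hg : ContDiff ℝ 1 g) {t₀ : ℝ}
    (hg0 : deriv g t₀ ≠ 0) (hemb : MeasurableEmbedding g) {r : ℝ≥0} (hr : 1 < r) :
    ∃ U ∈ 𝓝 t₀,
      (μH[1].comap g).restrict U ≤
        (r • volume.withDensity fun t => ‖deriv g t‖ₑ).restrict U ∧
      (volume.withDensity fun t => ‖deriv g t‖ₑ).restrict U ≤
        (r • μH[1].comap g).restrict U := by
  set m : ℝ≥0 := ‖deriv g t₀‖₊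
  have hm : 0 < m := nnnorm_pos.2 hg0
  set L : ℝ≥0 := 2 * m / (1 + r)
  have hLm : L < m := by
    rw [div_lt_iff₀ (by positivity)]
    nlinarith
  have hmM : m < r * L := by
    rw [← mul_div_assoc, lt_div_iff₀ (by positivity)]
    nlinarith
  obtain ⟨U, hU, hdist⟩ :=
    exists_nhds_bilipschitz (hg.contDiffAt.hasStrictDerivAt one_ne_zero) hLm hmM
  have hspeed : ∀ᶠ t in 𝓝 t₀, L < ‖deriv g t‖₊ ∧ ‖deriv g t‖₊ < r * L :=
    (hg.continuous_deriv le_rfl).nnnorm.continuousAt.eventually (Ioo_mem_nhds hLm hmM)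
  obtain ⟨V, hVspeed, hVo, hV⟩ := eventually_nhds_iff.1 hspeed
  refine ⟨interior U ∩ V, inter_mem (interior_mem_nhds.2 hU) (hVo.mem_nhds hV), ?_⟩
  have hUV : MeasurableSet (interior U ∩ V) := (isOpen_interior.inter hVo).measurableSet
  have hbounds : ∀ A ⊆ interior U ∩ V, MeasurableSet A →
      μH[1] (g '' A) ≤ r * ∫⁻ t in A, ‖deriv g t‖ₑ ∧
      ∫⁻ t in A, ‖deriv g t‖ₑ ≤ r * μH[1] (g '' A) := by
    intro A hA hAm
    have hμ := hausdorffMeasure_image_bounds hdist fun t ht => interior_subset (hA ht).1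
    have hν := setLIntegral_enorm_bounds (μ := volume) hAm fun t ht =>
      (hVspeed t (hA ht).2).imp le_of_lt le_of_lt
    simp only [ENNReal.coe_mul, mul_assoc] at hμ hν
    exact ⟨hμ.2.trans (by gcongr; exact hν.1), hν.2.trans (by gcongr; exact hμ.1)⟩
  constructor <;> refine Measure.le_iff.2 fun A hA => ?_ <;>
    rw [Measure.restrict_apply hA, Measure.restrict_apply hA, Measure.smul_apply,
      hemb.comap_apply, withDensity_apply _ (hA.inter hUV), ENNReal.smul_def, smul_eq_mul]
  · exact (hbounds _ Set.inter_subset_right (hA.inter hUV)).1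
  · exact (hbounds _ Set.inter_subset_right (hA.inter hUV)).2

lemma comap_hausdorffMeasure_eq_withDensity {g : ℝ → E} (hg : ContDiff ℝ 1 g)
    (hg0 : ∀ t, deriv g t ≠ 0) (hemb : MeasurableEmbedding g) :
    μH[1].comap g = volume.withDensity fun t => ‖deriv g t‖ₑ := by
  apply le_antisymm <;>
    refine measure_le_of_forall_one_lt_smul fun r hr =>
      measure_le_of_locally_restrict_le fun t => ?_
  · exact (exists_nhds_comap_hausdorffMeasure_comparable hg (hg0 t) hemb hr).imp
      fun _ h => ⟨h.1, h.2.1⟩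
  · exact (exists_nhds_comap_hausdorffMeasure_comparable hg (hg0 t) hemb hr).imp
      fun _ h => ⟨h.1, h.2.2⟩

lemma hausdorffMeasure_image_eq_setLIntegral_enorm_deriv {g : ℝ → E} (hg : ContDiff ℝ 1 g)
    (hg0 : ∀ t, deriv g t ≠ 0) (hemb : MeasurableEmbedding g) {A : Set ℝ}
    (hA : MeasurableSet A) : μH[1] (g '' A) = ∫⁻ t in A, ‖deriv g t‖ₑ := by
  rw [← hemb.comap_apply, comap_hausdorffMeasure_eq_withDensity hg hg0 hemb,
    withDensity_apply _ hA]

lemma setIntegral_range_hausdorffMeasure {g : ℝ → E} (hg : ContDiff ℝ 1 g)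
    (hg0 : ∀ t, deriv g t ≠ 0) (hemb : MeasurableEmbedding g) {F : Type*}
    [NormedAddCommGroup F] [NormedSpace ℝ F] (φ : E → F) :
    ∫ x in Set.range g, φ x ∂μH[1] = ∫ t, ‖deriv g t‖ • φ (g t) := by
  have hspeed : Continuous fun t => ‖deriv g t‖ₑ := (hg.continuous_deriv le_rfl).enorm
  rw [← hemb.map_comap, hemb.integral_map, comap_hausdorffMeasure_eq_withDensity hg hg0 hemb,
    integral_withDensity_eq_integral_toReal_smul hspeed.measurable (by simp)]
  simp

end AreaFormula

/-! ### Graphs -/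

/-- The length element `√(1 + f'²)` of the graph of `f`. -/
noncomputable def graphSpeed (f : ℝ → ℝ) (s : ℝ) : ℝ := √(1 + deriv f s ^ 2)

/-- The upward unit normal of the graph of `f` in the coordinates `e`, extended constantly in the
vertical direction so that it is a vector field on the whole plane. -/
noncomputable def chartNormal (e : Plane ≃ₗᵢ[ℝ] Plane) (f : ℝ → ℝ) (y : Plane) : Plane :=
  planeCoord e (-deriv f ((e y) 0) / graphSpeed f ((e y) 0), 1 / graphSpeed f ((e y) 0))

/-- The parametrisation `s ↦ (s, f s)` of the graph of `f` in the coordinates `e`. -/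
noncomputable def graphCurve (e : Plane ≃ₗᵢ[ℝ] Plane) (f : ℝ → ℝ) (s : ℝ) : Plane :=
  planeCoord e (s, f s)

section Graph

variable (e : Plane ≃ₗᵢ[ℝ] Plane) (f : ℝ → ℝ)

lemma graphSpeed_pos (s : ℝ) : 0 < graphSpeed f s :=
  Real.sqrt_pos.2 (by positivity)

lemma one_le_graphSpeed (s : ℝ) : 1 ≤ graphSpeed f s :=
  Real.one_le_sqrt.2 (le_add_of_nonneg_right (sq_nonneg _))

lemma graphSpeed_sq (s : ℝ) : graphSpeed f s ^ 2 = 1 + deriv f s ^ 2 :=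
  Real.sq_sqrt (by positivity)

lemma norm_chartNormal (y : Plane) : ‖chartNormal e f y‖ = 1 := by
  have hpos := graphSpeed_pos f ((e y) 0)
  rw [chartNormal, norm_planeCoord, Real.sqrt_eq_one]
  field_simp
  rw [graphSpeed_sq, add_comm]

lemma graphSpeed_mul_inner_chartNormal (y z : Plane) :
    graphSpeed f ((e y) 0) * inner ℝ (chartNormal e f y) z =
      (e z) 1 - deriv f ((e y) 0) * (e z) 0 := by
  have hpos := graphSpeed_pos f ((e y) 0)
  rw [chartNormal, inner_planeCoord]
  field_simp
  ring

@[simp] lemma apply_graphCurve_zero (s : ℝ) : (e (graphCurve e f s)) 0 = s :=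
  apply_planeCoord_zero e _

@[simp] lemma apply_graphCurve_one (s : ℝ) : (e (graphCurve e f s)) 1 = f s :=
  apply_planeCoord_one e _

variable {e f}

lemma graphCurve_apply_zero {y : Plane} (hy : (e y) 1 = f ((e y) 0)) :
    graphCurve e f ((e y) 0) = y := by
  rw [graphCurve, ← hy, planeCoord_coords]

lemma mem_range_graphCurve_iff {y : Plane} :
    y ∈ Set.range (graphCurve e f) ↔ (e y) 1 = f ((e y) 0) := by
  refine ⟨?_, fun hy => ⟨_, graphCurve_apply_zero hy⟩⟩
  rintro ⟨s, rfl⟩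
  simp

variable (e)

lemma measurableEmbedding_graphCurve (hf : Continuous f) :
    MeasurableEmbedding (graphCurve e f) :=
  ((planeCoord e).continuous.comp (continuous_id.prodMk hf)).measurableEmbedding
    fun _ _ hst => congrArg Prod.fst ((planeCoord e).injective hst)

lemma contDiff_graphCurve {n : WithTop ℕ∞} (hf : ContDiff ℝ n f) :
    ContDiff ℝ n (graphCurve e f) :=
  (planeCoord e).contDiff.comp (contDiff_id.prodMk hf)

lemma deriv_graphCurve {s : ℝ} (hf : DifferentiableAt ℝ f s) :
    deriv (graphCurve e f) s = planeCoord e (1, deriv f s) :=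
  ((planeCoord e : ℝ × ℝ →L[ℝ] Plane).hasFDerivAt.comp_hasDerivAt s
    ((hasDerivAt_id s).prodMk hf.hasDerivAt)).deriv

lemma norm_deriv_graphCurve {s : ℝ} (hf : DifferentiableAt ℝ f s) :
    ‖deriv (graphCurve e f) s‖ = graphSpeed f s := by
  rw [deriv_graphCurve e hf, norm_planeCoord, graphSpeed, one_pow]

lemma deriv_graphCurve_ne_zero {s : ℝ} (hf : DifferentiableAt ℝ f s) :
    deriv (graphCurve e f) s ≠ 0 := by
  rw [← norm_pos_iff, norm_deriv_graphCurve e hf]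
  exact graphSpeed_pos f s

lemma contDiff_graphSpeed {n : WithTop ℕ∞} (hf : ContDiff ℝ n (deriv f)) :
    ContDiff ℝ n (graphSpeed f) :=
  (contDiff_const.add (hf.pow 2)).sqrt fun _ => by positivity

lemma contDiff_chartNormal {n : WithTop ℕ∞} (hf : ContDiff ℝ n (deriv f)) :
    ContDiff ℝ n (chartNormal e f) := by
  have hcoord : ContDiff ℝ n fun y => (e y) 0 := contDiff_coord e 0
  have hspeed := (contDiff_graphSpeed hf).comp hcoord
  exact (planeCoord e).contDiff.comp
    (((hf.comp hcoord).neg.div hspeed fun _ => (graphSpeed_pos f _).ne').prodMk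
      (contDiff_const.div hspeed fun _ => (graphSpeed_pos f _).ne'))

end Graph

/-- In the open set `U`, the set `Ω` is the strict subgraph of the smooth function `f` in the
Cartesian coordinates `e`. -/
structure IsGraphChart (Ω U : Set Plane) (e : Plane ≃ₗᵢ[ℝ] Plane) (f : ℝ → ℝ) : Prop where
  isOpen : IsOpen U
  contDiff : ContDiff ℝ ∞ f
  mem_iff : ∀ y ∈ U, (y ∈ Ω ↔ (e y) 1 < f ((e y) 0))

namespace IsGraphChart

variable {Ω U : Set Plane} {e : Plane ≃ₗᵢ[ℝ] Plane} {f : ℝ → ℝ}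

lemma contDiff_two (h : IsGraphChart Ω U e f) : ContDiff ℝ 2 f :=
  h.contDiff.of_le (by norm_cast)

lemma contDiff_deriv (h : IsGraphChart Ω U e f) : ContDiff ℝ ∞ (deriv f) :=
  h.contDiff.iterate_deriv 1

lemma differentiable (h : IsGraphChart Ω U e f) : Differentiable ℝ f :=
  h.contDiff.differentiable (by simp)

lemma mem_closure (h : IsGraphChart Ω U e f) {y : Plane} (hy : y ∈ U)
    (hgraph : (e y) 1 = f ((e y) 0)) : y ∈ closure Ω := by
  have hlim : Tendsto (fun t : ℝ => y - t • planeCoord e (0, 1)) (𝓝[>] 0) (𝓝 y) := by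
    have hc : Continuous fun t : ℝ => y - t • planeCoord e (0, 1) := by fun_prop
    simpa using (hc.tendsto 0).mono_left nhdsWithin_le_nhds
  refine mem_closure_of_tendsto hlim ?_
  filter_upwards [hlim (h.isOpen.mem_nhds hy), self_mem_nhdsWithin] with t ht ht0
  refine (h.mem_iff _ ht).2 ?_
  simpa [hgraph] using ht0

lemma mem_frontier_iff (h : IsGraphChart Ω U e f) (hΩ : IsOpen Ω) {y : Plane} (hy : y ∈ U) :
    y ∈ frontier Ω ↔ (e y) 1 = f ((e y) 0) := by
  rw [hΩ.frontier_eq, Set.mem_sdiff, h.mem_iff y hy, not_lt]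
  refine ⟨fun ⟨hcl, hle⟩ => le_antisymm (not_lt.1 fun hlt => ?_) hle,
    fun heq => ⟨h.mem_closure hy heq, heq.ge⟩⟩
  have hopen : IsOpen {z | f ((e z) 0) < (e z) 1} :=
    isOpen_lt (h.contDiff.continuous.comp (contDiff_coord e 0 (n := 0)).continuous)
      (contDiff_coord e 1 (n := 0)).continuous
  obtain ⟨z, ⟨hzU, hz⟩, hzΩ⟩ := mem_closure_iff.1 hcl _ (h.isOpen.inter hopen) ⟨hy, hlt⟩
  exact lt_asymm hz ((h.mem_iff z hzU).1 hzΩ)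

lemma add_mem_iff (h : IsGraphChart Ω U e f) {y z : Plane} (hy : (e y) 1 = f ((e y) 0))
    (hz : y + z ∈ U) :
    y + z ∈ Ω ↔ graphSpeed f ((e y) 0) * inner ℝ (chartNormal e f y) z <
      f ((e y) 0 + (e z) 0) - f ((e y) 0) - deriv f ((e y) 0) * (e z) 0 := by
  rw [h.mem_iff _ hz, graphSpeed_mul_inner_chartNormal, map_add, PiLp.add_apply, PiLp.add_apply,
    hy]
  constructor <;> intro h <;> linarith

lemma setIntegral_frontier (h : IsGraphChart Ω U e f) (hΩ : IsOpen Ω) {φ : Plane → ℝ}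
    (hφ : ∀ y ∉ U, φ y = 0) :
    ∫ y in frontier Ω, φ y ∂μH[1] = ∫ s, graphSpeed f s * φ (graphCurve e f s) := by
  have hemb := measurableEmbedding_graphCurve e h.contDiff.continuous
  calc ∫ y in frontier Ω, φ y ∂μH[1]
      = ∫ y in Set.range (graphCurve e f), φ y ∂μH[1] := by
        rw [← integral_indicator isClosed_frontier.measurableSet,
          ← integral_indicator hemb.measurableSet_range]
        congr 1 with y
        by_cases hy : y ∈ U
        · classical
          simp only [Set.indicator_apply, mem_range_graphCurve_iff, h.mem_frontier_iff hΩ hy]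
        · simp only [Set.indicator_apply_eq_zero.2 fun _ => hφ y hy]
    _ = ∫ s, ‖deriv (graphCurve e f) s‖ • φ (graphCurve e f s) :=
        setIntegral_range_hausdorffMeasure
          (contDiff_graphCurve e (h.contDiff.of_le (mod_cast le_top)))
          (fun s => deriv_graphCurve_ne_zero e (h.differentiable s)) hemb φ
    _ = ∫ s, graphSpeed f s * φ (graphCurve e f s) := by
        simp_rw [norm_deriv_graphCurve e (h.differentiable _), smul_eq_mul]

end IsGraphChart

namespace IsRegularSet

variable {Ω : Set Plane}

lemma exists_isGraphChart (hΩ : IsRegularSet Ω) {x : Plane} (hx : x ∈ frontier Ω) :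
    ∃ (r : ℝ) (e : Plane ≃ₗᵢ[ℝ] Plane) (f : ℝ → ℝ), 0 < r ∧
      IsGraphChart Ω (Metric.ball x r) e f := by
  obtain ⟨r, hr, e, f, hf, h⟩ := hΩ.smooth_boundary x hx
  exact ⟨r, e, f, hr, Metric.isOpen_ball, hf, h⟩

lemma isCompact_frontier (hΩ : IsRegularSet Ω) : IsCompact (frontier Ω) :=
  Metric.isCompact_of_isClosed_isBounded isClosed_frontier
    (hΩ.isBounded.closure.subset frontier_subset_closure)

lemma hausdorffMeasure_frontier_lt_top (hΩ : IsRegularSet Ω) : μH[1] (frontier Ω) < ⊤ := by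
  refine hΩ.isCompact_frontier.measure_lt_top_of_nhdsWithin fun x hx => ?_
  obtain ⟨r, e, f, hr, h⟩ := hΩ.exists_isGraphChart hx
  refine ⟨frontier Ω ∩ Metric.ball x r, inter_mem_nhdsWithin _ (Metric.ball_mem_nhds x hr), ?_⟩
  set I := Metric.closedBall ((e x) 0) r
  have hsub : frontier Ω ∩ Metric.ball x r ⊆ graphCurve e f '' I := by
    rintro y ⟨hy, hyU⟩
    refine ⟨(e y) 0, ?_, graphCurve_apply_zero ((h.mem_frontier_iff hΩ.isOpen hyU).1 hy)⟩
    rw [Metric.mem_closedBall, Real.dist_eq, ← PiLp.sub_apply, ← map_sub]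
    exact (abs_coord_le_norm e (y - x) 0).trans (mem_ball_iff_norm.1 hyU).le
  have hC1 : ContDiff ℝ 1 (graphCurve e f) :=
    contDiff_graphCurve e (h.contDiff.of_le (mod_cast le_top))
  refine (measure_mono hsub).trans_lt ?_
  rw [hausdorffMeasure_image_eq_setLIntegral_enorm_deriv hC1
    (fun s => deriv_graphCurve_ne_zero e (h.differentiable s))
    (measurableEmbedding_graphCurve e h.contDiff.continuous)
    Metric.isClosed_closedBall.measurableSet]
  exact ((hC1.continuous_deriv le_rfl).continuousOn.integrableOn_compact
    (isCompact_closedBall _ _)).2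

lemma isFiniteMeasure_frontier (hΩ : IsRegularSet Ω) :
    IsFiniteMeasure ((μH[1] : Measure Plane).restrict (frontier Ω)) :=
  isFiniteMeasure_restrict.2 hΩ.hausdorffMeasure_frontier_lt_top.ne

lemma integrableOn_frontier (hΩ : IsRegularSet Ω) {E : Type*} [NormedAddCommGroup E]
    {φ : Plane → E} (hφ : ContinuousOn φ (frontier Ω)) : IntegrableOn φ (frontier Ω) μH[1] :=
  hφ.integrableOn_of_subset_isCompact hΩ.isCompact_frontier
    isClosed_frontier.measurableSet subset_rfl hΩ.hausdorffMeasure_frontier_lt_top.ne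

end IsRegularSet

/-! ### Parabolic tangency -/

lemma abs_taylor_one_remainder_le {f : ℝ → ℝ} {s t C : ℝ} (hf : Differentiable ℝ f)
    (hf' : Differentiable ℝ (deriv f)) (hC : ∀ u ∈ Set.uIcc s t, |deriv (deriv f) u| ≤ C) :
    |f t - f s - deriv f s * (t - s)| ≤ C * (t - s) ^ 2 := by
  have hderiv : ∀ u ∈ Set.uIcc s t, ‖deriv f u - deriv f s‖ ≤ C * |t - s| := fun u hu =>
    ((convex_uIcc s t).norm_image_sub_le_of_norm_deriv_le (fun x _ => hf' x) hC
      Set.left_mem_uIcc hu).trans <| by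
        have hC0 : 0 ≤ C := (abs_nonneg _).trans (hC u hu)
        gcongr
        exact Set.abs_sub_left_of_mem_uIcc hu
  have hmvt := (convex_uIcc s t).norm_image_sub_le_of_norm_hasDerivWithin_le
    (f := fun u => f u - deriv f s * u) (f' := fun u => deriv f u - deriv f s)
    (fun u _ => by
      simpa using ((hf u).hasDerivAt.fun_sub
        ((hasDerivAt_id' u).const_mul (deriv f s))).hasDerivWithinAt)
    hderiv Set.left_mem_uIcc Set.right_mem_uIcc
  calc |f t - f s - deriv f s * (t - s)|
      = ‖f t - deriv f s * t - (f s - deriv f s * s)‖ := by rw [Real.norm_eq_abs]; ring_nf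
    _ ≤ C * |t - s| * ‖t - s‖ := hmvt
    _ = C * (t - s) ^ 2 := by rw [Real.norm_eq_abs, mul_assoc, ← sq, sq_abs]

lemma exists_taylor_one_remainder_bound {f : ℝ → ℝ} (hf : ContDiff ℝ 2 f) (a b : ℝ) :
    ∃ C, 0 ≤ C ∧ ∀ s ∈ Set.Icc a b, ∀ t ∈ Set.Icc a b,
      |f t - f s - deriv f s * (t - s)| ≤ C * (t - s) ^ 2 := by
  have hd : ContDiff ℝ 1 (deriv f) := hf.deriv' (n := 1)
  obtain ⟨C, hC⟩ := isCompact_Icc.exists_bound_of_continuousOn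
    (hd.continuous_deriv le_rfl).continuousOn (s := Set.Icc a b)
  refine ⟨|C|, abs_nonneg C, fun s hs t ht =>
    abs_taylor_one_remainder_le (hf.differentiable two_ne_zero) (hd.differentiable one_ne_zero)
      fun u hu => (hC u ?_).trans (le_abs_self C)⟩
  exact Set.ordConnected_Icc.uIcc_subset hs ht hu

lemma eventually_mul_sq_lt_mul (C : ℝ) {c : ℝ} (hc : 0 < c) :
    ∀ᶠ s in 𝓝[>] (0 : ℝ), C * s ^ 2 < c * s := by
  have hlim : Tendsto (fun s : ℝ => C * s) (𝓝[>] 0) (𝓝 0) := by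
    simpa using ((continuous_const_mul C).tendsto 0).mono_left nhdsWithin_le_nhds
  filter_upwards [hlim.eventually_lt_const hc, self_mem_nhdsWithin] with s hs hs0
  rw [sq, ← mul_assoc]
  exact mul_lt_mul_of_pos_right hs hs0

/-- `Ω` lies between two parabolas tangent at `y` to the line orthogonal to `n`, which thus plays
the role of an outer normal. -/
def IsParabolicTangent (Ω : Set Plane) (y n : Plane) (C : ℝ) : Prop :=
  ∀ z, (inner ℝ n z < -(C * ‖z‖ ^ 2) → y + z ∈ Ω) ∧ (C * ‖z‖ ^ 2 < inner ℝ n z → y + z ∉ Ω)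

namespace IsParabolicTangent

variable {Ω : Set Plane} {y n m : Plane} {C D : ℝ}

lemma mono (h : IsParabolicTangent Ω y n C) (hCD : C ≤ D) : IsParabolicTangent Ω y n D := by
  intro z
  have hle : C * ‖z‖ ^ 2 ≤ D * ‖z‖ ^ 2 := by gcongr
  exact ⟨fun hz => (h z).1 (by linarith), fun hz => (h z).2 (by linarith)⟩

lemma of_norm_lt {δ : ℝ} (hδ : 0 < δ) (hn : ‖n‖ ≤ 1) (hC : 0 ≤ C)
    (h : ∀ z, ‖z‖ < δ → (inner ℝ n z < -(C * ‖z‖ ^ 2) → y + z ∈ Ω) ∧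
      (C * ‖z‖ ^ 2 < inner ℝ n z → y + z ∉ Ω)) :
    IsParabolicTangent Ω y n (C + 1 / δ) := by
  intro z
  have hCz : 0 ≤ C * ‖z‖ ^ 2 := by positivity
  have hδz : 0 ≤ 1 / δ * ‖z‖ ^ 2 := by positivity
  rw [add_mul]
  rcases lt_or_ge ‖z‖ δ with hz | hz
  · exact ⟨fun hlt => (h z hz).1 (by linarith), fun hlt => (h z hz).2 (by linarith)⟩
  · have hfar : ‖z‖ ≤ 1 / δ * ‖z‖ ^ 2 := by
      rw [one_div_mul_eq_div, le_div_iff₀ hδ, sq]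
      gcongr
    have hinner : |inner ℝ n z| ≤ ‖z‖ := (abs_real_inner_le_norm n z).trans
      (mul_le_of_le_one_left (norm_nonneg z) hn)
    exact ⟨fun hlt => by linarith [neg_abs_le (inner ℝ n z)],
      fun hlt => by linarith [le_abs_self (inner ℝ n z)]⟩

lemma eventually_add_smul_mem (h : IsParabolicTangent Ω y n C) {w : Plane}
    (hw : inner ℝ n w < 0) : ∀ᶠ s in 𝓝[>] (0 : ℝ), y + s • w ∈ Ω := by
  filter_upwards [eventually_mul_sq_lt_mul (C * ‖w‖ ^ 2) (neg_pos.2 hw)] with s hs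
  refine (h (s • w)).1 ?_
  rw [inner_smul_right, norm_smul, mul_pow, Real.norm_eq_abs, sq_abs]
  linarith

lemma eventually_add_smul_notMem (h : IsParabolicTangent Ω y n C) {w : Plane}
    (hw : 0 < inner ℝ n w) : ∀ᶠ s in 𝓝[>] (0 : ℝ), y + s • w ∉ Ω := by
  filter_upwards [eventually_mul_sq_lt_mul (C * ‖w‖ ^ 2) hw] with s hs
  refine (h (s • w)).2 ?_
  rw [inner_smul_right, norm_smul, mul_pow, Real.norm_eq_abs, sq_abs]
  linarith

lemma normal_unique (hn : IsParabolicTangent Ω y n C) (hm : IsParabolicTangent Ω y m D)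
    (hn1 : ‖n‖ = 1) (hm1 : ‖m‖ = 1) : n = m := by
  by_contra hne
  have hlt : inner ℝ n m < 1 := (inner_lt_one_iff_real_of_norm_eq_one hn1 hm1).2 hne
  -- Moving from `y` in the direction `m - n` would both enter and leave `Ω`.
  have hin : inner ℝ n (m - n) < 0 := by
    rw [inner_sub_right, real_inner_self_eq_norm_sq, hn1]
    linarith
  have hout : 0 < inner ℝ m (m - n) := by
    rw [inner_sub_right, real_inner_self_eq_norm_sq, hm1, real_inner_comm]
    linarith
  obtain ⟨s, hs, hs'⟩ :=
    ((hn.eventually_add_smul_mem hin).and (hm.eventually_add_smul_notMem hout)).exists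
  exact hs' hs

end IsParabolicTangent

namespace IsGraphChart

variable {Ω U : Set Plane} {e : Plane ≃ₗᵢ[ℝ] Plane} {f : ℝ → ℝ}

lemma exists_isParabolicTangent (h : IsGraphChart Ω U e f) (hΩ : IsOpen Ω) {x : Plane}
    (hx : x ∈ U) :
    ∃ C, ∀ᶠ y in 𝓝 x, y ∈ frontier Ω → IsParabolicTangent Ω y (chartNormal e f y) C := by
  obtain ⟨r, hr, hrU⟩ := Metric.isOpen_iff.1 h.isOpen x hx
  obtain ⟨C, hC0, hC⟩ := exists_taylor_one_remainder_bound
    h.contDiff_two ((e x) 0 - r) ((e x) 0 + r)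
  have hcoord : ∀ y ∈ Metric.ball x r, (e y) 0 ∈ Set.Icc ((e x) 0 - r) ((e x) 0 + r) := by
    intro y hy
    rw [← Real.closedBall_eq_Icc, Metric.mem_closedBall, Real.dist_eq, ← PiLp.sub_apply,
      ← map_sub]
    exact (abs_coord_le_norm e (y - x) 0).trans (mem_ball_iff_norm.1 hy).le
  refine ⟨C + 1 / (r / 2), ?_⟩
  filter_upwards [Metric.ball_mem_nhds x (half_pos hr)] with y hy hyΩ
  have hyr : y ∈ Metric.ball x r := Metric.ball_subset_ball (half_le_self hr.le) hy
  refine .of_norm_lt (half_pos hr) (norm_chartNormal e f y).le hC0 fun z hz => ?_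
  have hyz : y + z ∈ Metric.ball x r := by
    rw [mem_ball_iff_norm] at hy ⊢
    calc ‖y + z - x‖ = ‖(y - x) + z‖ := by congr 1; abel
      _ ≤ ‖y - x‖ + ‖z‖ := norm_add_le _ _
      _ < r := by linarith
  have hTaylor := abs_le.1 (hC _ (hcoord y hyr) _ (hcoord _ hyz))
  have hsq : C * (e z) 0 ^ 2 ≤ C * ‖z‖ ^ 2 := by
    rw [← sq_abs ((e z) 0)]
    gcongr
    exact abs_coord_le_norm e z 0
  have hspeed := one_le_graphSpeed f ((e y) 0)
  have hCz : 0 ≤ C * ‖z‖ ^ 2 := by positivity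
  rw [h.add_mem_iff ((h.mem_frontier_iff hΩ (hrU hyr)).1 hyΩ) (hrU hyz), not_lt]
  simp only [map_add, PiLp.add_apply, add_sub_cancel_left] at hTaylor
  exact ⟨fun hlt => by nlinarith, fun hlt => by nlinarith⟩

lemma chartNormal_eq {U' : Set Plane} {e' : Plane ≃ₗᵢ[ℝ] Plane} {f' : ℝ → ℝ}
    (h : IsGraphChart Ω U e f) (h' : IsGraphChart Ω U' e' f') (hΩ : IsOpen Ω) {y : Plane}
    (hy : y ∈ U) (hy' : y ∈ U') (hyΩ : y ∈ frontier Ω) :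
    chartNormal e f y = chartNormal e' f' y := by
  obtain ⟨C, hC⟩ := h.exists_isParabolicTangent hΩ hy
  obtain ⟨D, hD⟩ := h'.exists_isParabolicTangent hΩ hy'
  exact (hC.self_of_nhds hyΩ).normal_unique (hD.self_of_nhds hyΩ) (norm_chartNormal _ _ _)
    (norm_chartNormal _ _ _)

end IsGraphChart

/-! ### Curvature -/

lemma taylor_two_isLittleO {f : ℝ → ℝ} (hf : ContDiff ℝ 2 f) (s : ℝ) :
    (fun h => f (s + h) - f s - deriv f s * h - deriv (deriv f) s / 2 * h ^ 2) =o[𝓝 0]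
      fun h => h ^ 2 := by
  have hlim : Tendsto (fun h : ℝ => s + h) (𝓝 0) (𝓝 s) := by
    simpa using (continuous_const_add s).tendsto 0
  have htaylor := (taylor_isLittleO_univ (n := 2) (x₀ := s) (mod_cast hf)).comp_tendsto hlim
  refine htaylor.congr (fun h => ?_) (fun h => by simp)
  simp only [Function.comp_apply, taylorWithinEval_succ, taylor_within_zero_eval,
    iteratedDerivWithin_univ, iteratedDeriv_succ, iteratedDeriv_zero]
  norm_num
  ring

lemma tendsto_sq_mul_taylor_one_remainder {f : ℝ → ℝ} (hf : ContDiff ℝ 2 f) (s : ℝ) {H : ℝ → ℝ}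
    {l : ℝ} (hH : Tendsto (fun a => a * H a) atTop (𝓝 l)) :
    Tendsto (fun a => a ^ 2 * (f (s + H a) - f s - deriv f s * H a)) atTop
      (𝓝 (deriv (deriv f) s / 2 * l ^ 2)) := by
  have hH0 : Tendsto H atTop (𝓝 0) := by
    have hprod := tendsto_inv_atTop_zero.mul hH
    rw [zero_mul] at hprod
    refine hprod.congr' ?_
    filter_upwards [eventually_ne_atTop 0] with a ha
    exact inv_mul_cancel_left₀ ha _
  have herror := ((isBigO_refl (fun a : ℝ => a ^ 2) atTop).mul_isLittleO
    ((taylor_two_isLittleO hf s).comp_tendsto hH0)).trans_isBigO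
    (((hH.pow 2).isBigO_one ℝ).congr_left fun a => mul_pow _ _ _)
  have hlim := ((isLittleO_one_iff ℝ).1 herror).add
    ((hH.pow 2).const_mul (deriv (deriv f) s / 2))
  rw [zero_add] at hlim
  refine hlim.congr fun a => ?_
  simp only [Function.comp_apply]
  ring

lemma tendsto_parabolic_scaling (u v : ℝ) :
    Tendsto (fun a : ℝ => (u / a, v / a ^ 2)) atTop (𝓝 0) :=
  (tendsto_const_nhds.div_atTop tendsto_id).prodMk_nhds
    (tendsto_const_nhds.div_atTop (tendsto_pow_atTop two_ne_zero))

lemma tendsto_smul_parabolic_scaling (u v : ℝ) :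
    Tendsto (fun a : ℝ => a • (u / a, v / a ^ 2)) atTop (𝓝 (u, 0)) := by
  have hlim : Tendsto (fun a : ℝ => (u, v / a)) atTop (𝓝 (u, 0)) :=
    tendsto_const_nhds.prodMk_nhds (tendsto_const_nhds.div_atTop tendsto_id)
  refine hlim.congr' ?_
  filter_upwards [eventually_ne_atTop 0] with a ha
  ext <;> simp <;> field_simp

lemma sq_inner_perp (v w : Plane) :
    inner ℝ (perp v) w ^ 2 = ‖v‖ ^ 2 * ‖w‖ ^ 2 - inner ℝ v w ^ 2 := by
  simp only [EuclideanSpace.real_norm_sq_eq, Fin.sum_univ_two, inner_plane, perp,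
    Matrix.cons_val_zero, Matrix.cons_val_one]
  ring

/-- The curvature of the graph of `f`, up to sign. -/
noncomputable def graphCurvature (f : ℝ → ℝ) (s : ℝ) : ℝ :=
  deriv (deriv f) s / graphSpeed f s ^ 3

lemma continuous_graphCurvature {f : ℝ → ℝ} (hf : ContDiff ℝ 2 f) :
    Continuous (graphCurvature f) := by
  have hf' : ContDiff ℝ 1 (deriv f) := hf.deriv' (n := 1)
  exact (hf'.continuous_deriv le_rfl).div ((contDiff_graphSpeed hf').continuous.pow 3)
    fun s => pow_ne_zero 3 (graphSpeed_pos f s).ne'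

lemma norm_sq_of_tangent (e : Plane ≃ₗᵢ[ℝ] Plane) {f : ℝ → ℝ} {s : ℝ} {v : Plane}
    (hv : (e v) 1 = deriv f s * (e v) 0) : ‖v‖ ^ 2 = (e v) 0 ^ 2 * graphSpeed f s ^ 2 := by
  rw [norm_sq_eq_coords e, hv, graphSpeed_sq]
  ring

lemma hasDerivAt_coord (e : Plane ≃ₗᵢ[ℝ] Plane) (i : Fin 2) {γ : ℝ → Plane} {γ' : Plane} {t : ℝ}
    (hγ : HasDerivAt γ γ' t) : HasDerivAt (fun t => (e (γ t)) i) ((e γ') i) t :=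
  ((EuclideanSpace.proj (𝕜 := ℝ) i).comp
    (e.toContinuousLinearEquiv : Plane →L[ℝ] Plane)).hasFDerivAt.comp_hasDerivAt t hγ

section CurveInGraph

variable {e : Plane ≃ₗᵢ[ℝ] Plane} {f : ℝ → ℝ} {γ : ℝ → Plane} {t : ℝ}

lemma deriv_curve_of_mem_graph (hf : Differentiable ℝ f) (hγ : DifferentiableAt ℝ γ t)
    (hgraph : ∀ᶠ u in 𝓝 t, (e (γ u)) 1 = f ((e (γ u)) 0)) :
    (e (deriv γ t)) 1 = deriv f ((e (γ t)) 0) * (e (deriv γ t)) 0 :=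
  (hasDerivAt_coord e 1 hγ.hasDerivAt).unique <|
    ((hf _).hasDerivAt.comp t (hasDerivAt_coord e 0 hγ.hasDerivAt)).congr_of_eventuallyEq hgraph

lemma deriv_deriv_curve_of_mem_graph (hf : ContDiff ℝ 2 f) (hγ : ContDiffAt ℝ 2 γ t)
    (hgraph : ∀ᶠ u in 𝓝 t, (e (γ u)) 1 = f ((e (γ u)) 0)) :
    (e (deriv (deriv γ) t)) 1 = deriv (deriv f) ((e (γ t)) 0) * (e (deriv γ t)) 0 ^ 2 +
      deriv f ((e (γ t)) 0) * (e (deriv (deriv γ) t)) 0 := by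
  have hf' : Differentiable ℝ (deriv f) := hf.differentiable_deriv_two
  have hγ' : ∀ᶠ u in 𝓝 t, DifferentiableAt ℝ γ u := by
    filter_upwards [hγ.eventually (by simp)] with u hu
    exact hu.differentiableAt two_ne_zero
  have hγ'' : HasDerivAt (deriv γ) (deriv (deriv γ) t) t :=
    ((hγ.derivWithin (m := 1) le_rfl).differentiableAt one_ne_zero).hasDerivAt
  have htangent : ∀ᶠ u in 𝓝 t,
      (e (deriv γ u)) 1 = deriv f ((e (γ u)) 0) * (e (deriv γ u)) 0 := by
    filter_upwards [hgraph.eventually_nhds, hγ'] with u hu hu'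
    exact deriv_curve_of_mem_graph (hf.differentiable two_ne_zero) hu' hu
  rw [sq, ← mul_assoc]
  exact (hasDerivAt_coord e 1 hγ'').unique <|
    (((hf' _).hasDerivAt.comp t (hasDerivAt_coord e 0 hγ'.self_of_nhds.hasDerivAt)).mul
      (hasDerivAt_coord e 0 hγ'')).congr_of_eventuallyEq htangent

lemma sq_curvature_of_mem_graph (hf : ContDiff ℝ 2 f) (hγ : ContDiffAt ℝ 2 γ t)
    (hγt : deriv γ t ≠ 0) (hgraph : ∀ᶠ u in 𝓝 t, (e (γ u)) 1 = f ((e (γ u)) 0)) :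
    (inner ℝ (perp (deriv γ t)) (deriv (deriv γ) t) / ‖deriv γ t‖ ^ 3) ^ 2 =
      graphCurvature f ((e (γ t)) 0) ^ 2 := by
  have hv := deriv_curve_of_mem_graph (hf.differentiable two_ne_zero)
    (hγ.differentiableAt two_ne_zero) hgraph
  have hw := deriv_deriv_curve_of_mem_graph hf hγ hgraph
  have hnorm := norm_sq_of_tangent e hv
  have hspeed := graphSpeed_pos f ((e (γ t)) 0)
  have hv0 : (e (deriv γ t)) 0 ≠ 0 := fun h0 => hγt (by simpa [h0] using hnorm)
  have hinner : inner ℝ (perp (e (deriv γ t))) (e (deriv (deriv γ) t)) =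
      (e (deriv γ t)) 0 ^ 3 * deriv (deriv f) ((e (γ t)) 0) := by
    rw [inner_plane, hw]
    simp only [perp, Matrix.cons_val_zero, Matrix.cons_val_one, hv]
    ring
  -- `e` may reverse the orientation, which changes the sign of `⟪v^⊥, w⟫` but not its square.
  have hinner_sq : inner ℝ (perp (deriv γ t)) (deriv (deriv γ) t) ^ 2 =
      ((e (deriv γ t)) 0 ^ 3 * deriv (deriv f) ((e (γ t)) 0)) ^ 2 := by
    rw [← hinner, sq_inner_perp, sq_inner_perp, e.inner_map_map, e.norm_map, e.norm_map]
  rw [div_pow, hinner_sq, ← pow_mul, mul_comm 3 2, pow_mul, hnorm, graphCurvature]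
  field_simp

end CurveInGraph

lemma exists_smul_inner_perp_neg {v n : Plane} (hv : v ≠ 0) (hn : n ≠ 0)
    (hvn : inner ℝ v n = 0) : ∃ c : ℝ, c ≠ 0 ∧ inner ℝ n (perp (c • v)) < 0 := by
  have hperp : inner ℝ (perp v) n ≠ 0 := by
    rw [← sq_pos_iff, sq_inner_perp, hvn, zero_pow two_ne_zero, sub_zero]
    exact mul_pos (pow_pos (norm_pos_iff.2 hv) 2) (pow_pos (norm_pos_iff.2 hn) 2)
  refine ⟨-inner ℝ (perp v) n, neg_ne_zero.2 hperp, ?_⟩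
  have hsmul (c : ℝ) : perp (c • v) = c • perp v := by
    ext i
    fin_cases i <;> simp [perp]
  rw [hsmul, inner_smul_right, real_inner_comm (perp v) n, neg_mul, neg_lt_zero]
  exact mul_self_pos.2 hperp

namespace IsGraphChart

variable {Ω U : Set Plane} {e : Plane ≃ₗᵢ[ℝ] Plane} {f : ℝ → ℝ} {y : Plane}

lemma exists_hasBoundaryCurvature (h : IsGraphChart Ω U e f) (hΩ : IsOpen Ω) (hy : y ∈ U)
    (hyΩ : y ∈ frontier Ω) : ∃ k, HasBoundaryCurvature Ω y k := by
  set s := (e y) 0 with hs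
  have hcurve : ContDiff ℝ 2 (graphCurve e f) := contDiff_graphCurve e h.contDiff_two
  have htangent := deriv_graphCurve_ne_zero e (h.differentiable s)
  have horthogonal : inner ℝ (deriv (graphCurve e f) s) (chartNormal e f y) = 0 := by
    refine real_inner_comm _ _ |>.trans <| (mul_eq_zero.1 ?_).resolve_left (graphSpeed_pos f s).ne'
    rw [graphSpeed_mul_inner_chartNormal, deriv_graphCurve e (h.differentiable s)]
    simp [hs]
  obtain ⟨c, hc, hinward⟩ := exists_smul_inner_perp_neg htangent
    (norm_ne_zero_iff.1 (by rw [norm_chartNormal e f y]; exact one_ne_zero)) horthogonal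
  set γ : ℝ → Plane := fun t => graphCurve e f (s + c * t)
  have hγ : ContDiff ℝ 2 γ := hcurve.comp (by fun_prop)
  have hγ0 : γ 0 = y := by
    simp only [γ, mul_zero, add_zero]
    exact graphCurve_apply_zero ((h.mem_frontier_iff hΩ hy).1 hyΩ)
  have hγ' : deriv γ 0 = c • deriv (graphCurve e f) s := by
    refine (deriv_comp_mul_left c (fun u => graphCurve e f (s + u)) 0).trans ?_
    rw [deriv_comp_const_add, mul_zero, add_zero]
  refine ⟨_, γ, hγ.contDiffAt, hγ0, hγ' ▸ smul_ne_zero hc htangent, ?_, ?_, rfl⟩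
  · filter_upwards [hγ.continuous.continuousAt (h.isOpen.mem_nhds (by rwa [hγ0]))] with t ht
    simp [h.mem_frontier_iff hΩ ht, γ]
  · obtain ⟨C, hC⟩ := h.exists_isParabolicTangent hΩ hy
    exact (hC.self_of_nhds hyΩ).eventually_add_smul_mem (hγ' ▸ hinward)

lemma curvature_sq (h : IsGraphChart Ω U e f) (hΩ : IsOpen Ω) (hy : y ∈ U)
    (hyΩ : y ∈ frontier Ω) : curvature Ω y ^ 2 = graphCurvature f ((e y) 0) ^ 2 := by
  have hex := h.exists_hasBoundaryCurvature hΩ hy hyΩ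
  rw [curvature, dif_pos hex]
  obtain ⟨γ, hγ, rfl, hγ', hfr, -, hk⟩ := hex.choose_spec
  rw [hk]
  refine sq_curvature_of_mem_graph h.contDiff_two hγ hγ' ?_
  filter_upwards [hfr, hγ.continuousAt (h.isOpen.mem_nhds hy)] with t ht htU
  exact (h.mem_frontier_iff hΩ htU).1 ht

lemma eventually_mem_parabolic_scaling (h : IsGraphChart Ω U e f) (hΩ : IsOpen Ω) (hy : y ∈ U)
    (hyΩ : y ∈ frontier Ω) {e' : Plane ≃ₗᵢ[ℝ] Plane}
    (he' : ∀ z, (e' z) 1 = inner ℝ (chartNormal e f y) z) {u v : ℝ}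
    (hv : v ≠ graphCurvature f ((e y) 0) / 2 * u ^ 2) :
    ∀ᶠ a : ℝ in atTop, (y + planeCoord e' (u / a, v / a ^ 2) ∈ Ω ↔
      v < graphCurvature f ((e y) 0) / 2 * u ^ 2) := by
  set s := (e y) 0
  have hspeed := graphSpeed_pos f s
  have hU : ∀ᶠ a : ℝ in atTop, y + planeCoord e' (u / a, v / a ^ 2) ∈ U := by
    have hlim := (((planeCoord e').continuous.tendsto 0).comp
      (tendsto_parabolic_scaling u v)).const_add y
    rw [map_zero, add_zero] at hlim
    exact hlim (h.isOpen.mem_nhds hy)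
  have htangent : graphSpeed f s ^ 2 * (e (planeCoord e' (u, 0))) 0 ^ 2 = u ^ 2 := by
    have hzero : graphSpeed f s * inner ℝ (chartNormal e f y) (planeCoord e' (u, 0)) = 0 := by
      rw [← he', apply_planeCoord_one, mul_zero]
    rw [graphSpeed_mul_inner_chartNormal] at hzero
    rw [mul_comm, ← norm_sq_of_tangent e (sub_eq_zero.1 hzero), norm_sq_eq_coords e',
      apply_planeCoord_zero, apply_planeCoord_one]
    ring
  set H : ℝ → ℝ := fun a => (e (planeCoord e' (u / a, v / a ^ 2))) 0
  have hH : Tendsto (fun a => a * H a) atTop (𝓝 ((e (planeCoord e' (u, 0))) 0)) := by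
    have hcont : Continuous fun p => (e (planeCoord e' p)) 0 :=
      (contDiff_coord e 0 (n := 0)).continuous.comp (planeCoord e').continuous
    refine ((hcont.tendsto _).comp (tendsto_smul_parabolic_scaling u v)).congr fun a => ?_
    simp only [Function.comp_apply, map_smul, PiLp.smul_apply, smul_eq_mul, H]
  have hlim := tendsto_sq_mul_taylor_one_remainder h.contDiff_two s hH
  have hvalue : deriv (deriv f) s / 2 * (e (planeCoord e' (u, 0))) 0 ^ 2 =
      graphSpeed f s * (graphCurvature f s / 2 * u ^ 2) := by
    rw [← htangent, graphCurvature]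
    field_simp
  rw [hvalue] at hlim
  have hkey : ∀ᶠ a : ℝ in atTop, (graphSpeed f s * v <
      a ^ 2 * (f (s + H a) - f s - deriv f s * H a) ↔ v < graphCurvature f s / 2 * u ^ 2) := by
    rcases lt_or_gt_of_ne hv with hlt | hgt
    · filter_upwards [hlim.eventually_const_lt (mul_lt_mul_of_pos_left hlt hspeed)] with a ha
      exact iff_of_true ha hlt
    · filter_upwards [hlim.eventually_lt_const (mul_lt_mul_of_pos_left hgt hspeed)] with a ha
      exact iff_of_false ha.le.not_gt hgt.le.not_gt
  filter_upwards [hU, hkey, eventually_gt_atTop 0] with a haU hakey ha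
  rw [h.add_mem_iff ((h.mem_frontier_iff hΩ hy).1 hyΩ) haU, ← hakey, ← he', apply_planeCoord_one,
    ← mul_div_assoc, div_lt_iff₀' (by positivity)]

end IsGraphChart

namespace IsRegularSet

variable {Ω : Set Plane}

lemma continuousOn_curvature_sq (hΩ : IsRegularSet Ω) :
    ContinuousOn (fun x => curvature Ω x ^ 2) (frontier Ω) := by
  intro x hx
  obtain ⟨r, e, f, hr, h⟩ := hΩ.exists_isGraphChart hx
  have hcont : Continuous fun y => graphCurvature f ((e y) 0) ^ 2 :=
    ((continuous_graphCurvature h.contDiff_two).comp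
      (contDiff_coord e 0 (n := 0)).continuous).pow 2
  refine hcont.continuousWithinAt.congr_of_eventuallyEq ?_
    (h.curvature_sq hΩ.isOpen (Metric.mem_ball_self hr) hx)
  filter_upwards [mem_nhdsWithin_of_mem_nhds (Metric.ball_mem_nhds x hr), self_mem_nhdsWithin]
    with y hyU hy
  exact h.curvature_sq hΩ.isOpen hyU hy

lemma integrableOn_curvature_sq (hΩ : IsRegularSet Ω) :
    IntegrableOn (fun x => curvature Ω x ^ 2) (frontier Ω) μH[1] :=
  hΩ.integrableOn_frontier hΩ.continuousOn_curvature_sq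

end IsRegularSet

/-! ### The divergence theorem -/

section Subgraph

variable {E : Type*} [NormedAddCommGroup E]

lemma hasCompactSupport_comp_of_leftInverse {X Y : Type*} [TopologicalSpace X] [T2Space X]
    [TopologicalSpace Y] {g : X → E} {γ : Y → X} {π : X → Y} (hg : HasCompactSupport g)
    (hπγ : Function.LeftInverse π γ) (hπ : Continuous π) (hγ : Continuous γ) :
    HasCompactSupport (g ∘ γ) :=
  hg.comp_isClosedEmbedding (hπγ.isClosedEmbedding hπ hγ)

variable [NormedSpace ℝ E]

lemma integrable_fderiv_apply_of_hasCompactSupport {F : Type*} [NormedAddCommGroup F]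
    [NormedSpace ℝ F] [MeasurableSpace F] [OpensMeasurableSpace F] {μ : Measure F}
    [IsFiniteMeasureOnCompacts μ] {G : F → E} (hG : ContDiff ℝ 1 G) (hGc : HasCompactSupport G)
    (v : F) : Integrable (fun p => fderiv ℝ G p v) μ :=
  (continuous_fderiv_apply_const hG v).integrable_of_hasCompactSupport (hGc.fderiv_apply ℝ v)

lemma hasDerivAt_slice_right {G : ℝ × ℝ → E} (hG : Differentiable ℝ G) (s u : ℝ) :
    HasDerivAt (fun u => G (s, u)) (fderiv ℝ G (s, u) (0, 1)) u :=
  (hG (s, u)).hasFDerivAt.comp_hasDerivAt u ((hasDerivAt_const u s).prodMk (hasDerivAt_id u))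

lemma hasDerivAt_slice_left {G : ℝ × ℝ → E} (hG : Differentiable ℝ G) (s u : ℝ) :
    HasDerivAt (fun s => G (s, u)) (fderiv ℝ G (s, u) (1, 0)) s :=
  (hG (s, u)).hasFDerivAt.comp_hasDerivAt s ((hasDerivAt_id s).prodMk (hasDerivAt_const s u))

lemma integral_lowerHalfPlane_smul_fderiv_snd [CompleteSpace E] {G : ℝ × ℝ → E}
    (hG : ContDiff ℝ 1 G) (hGc : HasCompactSupport G) {w : ℝ → ℝ} (hw : Continuous w) :
    ∫ q in Set.univ ×ˢ Set.Iio 0, w q.1 • fderiv ℝ G q (0, 1) = ∫ s, w s • G (s, 0) := by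
  have hint : Integrable fun q : ℝ × ℝ => w q.1 • fderiv ℝ G q (0, 1) :=
    ((hw.comp continuous_fst).smul (continuous_fderiv_apply_const hG _)
      ).integrable_of_hasCompactSupport (hGc.fderiv_apply ℝ (0, 1)).smul_left
  rw [Measure.volume_eq_prod, setIntegral_prod _ hint.integrableOn, Measure.restrict_univ]
  refine integral_congr_ae (Eventually.of_forall fun s => ?_)
  have hslice : Function.LeftInverse Prod.snd fun u : ℝ => (s, u) := fun _ => rfl
  have hderiv : deriv (fun u => G (s, u)) = fun u => fderiv ℝ G (s, u) (0, 1) :=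
    funext fun u => (hasDerivAt_slice_right (hG.differentiable one_ne_zero) s u).deriv
  have hFTC : ∫ u in Set.Iic 0, deriv (fun u => G (s, u)) u = G (s, 0) :=
    (hasCompactSupport_comp_of_leftInverse hGc hslice continuous_snd
      (by fun_prop)).integral_Iic_deriv_eq (hG.comp (contDiff_const.prodMk contDiff_id)) 0
  simp only [integral_smul, ← integral_Iic_eq_integral_Iio]
  rw [← hFTC, hderiv]

lemma integral_lowerHalfPlane_fderiv_fst {G : ℝ × ℝ → E} (hG : ContDiff ℝ 1 G)
    (hGc : HasCompactSupport G) :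
    ∫ q in Set.univ ×ˢ Set.Iio 0, fderiv ℝ G q (1, 0) = 0 := by
  have hint : Integrable fun q : ℝ × ℝ => fderiv ℝ G q (1, 0) :=
    integrable_fderiv_apply_of_hasCompactSupport hG hGc _
  rw [Measure.volume_eq_prod, ← Measure.prod_restrict, integral_prod_symm _
    (by rw [Measure.prod_restrict]; exact hint.integrableOn), Measure.restrict_univ]
  refine integral_eq_zero_of_ae (Eventually.of_forall fun u => ?_)
  have hslice : Function.LeftInverse Prod.fst fun s : ℝ => (s, u) := fun _ => rfl
  have hcont : Continuous fun s : ℝ => (s, u) := by fun_prop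
  exact integral_eq_zero_of_hasDerivAt_of_integrable
    (hasDerivAt_slice_left (hG.differentiable one_ne_zero) · u)
    (((continuous_fderiv_apply_const hG _).comp hcont).integrable_of_hasCompactSupport
      (hasCompactSupport_comp_of_leftInverse (hGc.fderiv_apply ℝ _) hslice continuous_fst hcont))
    ((hG.continuous.comp hcont).integrable_of_hasCompactSupport
      (hasCompactSupport_comp_of_leftInverse hGc hslice continuous_fst hcont))

/-- The shear `(s, u) ↦ (s, u + f s)`, which maps the lower half-plane onto the strict subgraph
of `f`. -/
@[simps apply]
def shear (f : ℝ → ℝ) (hf : Continuous f) : (ℝ × ℝ) ≃ₜ (ℝ × ℝ) where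
  toFun p := (p.1, p.2 + f p.1)
  invFun p := (p.1, p.2 - f p.1)
  left_inv p := by simp
  right_inv p := by simp
  continuous_toFun := by fun_prop
  continuous_invFun := by fun_prop

lemma measurePreserving_shear {f : ℝ → ℝ} (hf : Continuous f) :
    MeasurePreserving (shear f hf) :=
  (MeasurePreserving.id volume).skew_product (g := fun s u => u + f s)
    (measurable_snd.add (hf.measurable.comp measurable_fst))
    (Eventually.of_forall fun s => map_add_right_eq_self volume (f s))

lemma setIntegral_subgraph {f : ℝ → ℝ} (hf : Continuous f) (F : ℝ × ℝ → E) :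
    ∫ p in {p : ℝ × ℝ | p.2 < f p.1}, F p =
      ∫ q in Set.univ ×ˢ Set.Iio 0, F (shear f hf q) := by
  rw [← (measurePreserving_shear hf).setIntegral_preimage_emb (shear f hf).measurableEmbedding]
  congr 2
  ext q
  simp

variable {g : ℝ × ℝ → E} {f : ℝ → ℝ}

lemma fderiv_comp_shear (hg : Differentiable ℝ g) (hf : Differentiable ℝ f) (q v : ℝ × ℝ) :
    fderiv ℝ (g ∘ shear f hf.continuous) q v =
      fderiv ℝ g (shear f hf.continuous q) (v.1, v.2 + deriv f q.1 * v.1) := by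
  have hshear : HasFDerivAt (fun q : ℝ × ℝ => (q.1, q.2 + f q.1))
      ((ContinuousLinearMap.fst ℝ ℝ ℝ).prod (ContinuousLinearMap.snd ℝ ℝ ℝ +
        deriv f q.1 • ContinuousLinearMap.fst ℝ ℝ ℝ)) q :=
    hasFDerivAt_fst.prodMk (hasFDerivAt_snd.add
      ((hf q.1).hasDerivAt.comp_hasFDerivAt q hasFDerivAt_fst))
  exact congrArg (· v) ((hg (shear f hf.continuous q)).hasFDerivAt.comp q hshear).fderiv

lemma contDiff_comp_shear (hg : ContDiff ℝ 1 g) (hf : ContDiff ℝ 1 f) :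
    ContDiff ℝ 1 (g ∘ shear f hf.continuous) :=
  hg.comp (contDiff_fst.prodMk (contDiff_snd.add (hf.comp contDiff_fst)))

variable [CompleteSpace E]

lemma integral_subgraph_fderiv_snd (hg : ContDiff ℝ 1 g) (hgc : HasCompactSupport g)
    (hf : ContDiff ℝ 1 f) :
    ∫ p in {p : ℝ × ℝ | p.2 < f p.1}, fderiv ℝ g p (0, 1) = ∫ s, g (s, f s) := by
  have hhalf := integral_lowerHalfPlane_smul_fderiv_snd (contDiff_comp_shear hg hf)
    (hgc.comp_homeomorph (shear f hf.continuous)) (w := fun _ => 1) continuous_const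
  simp only [fderiv_comp_shear (hg.differentiable one_ne_zero) (hf.differentiable one_ne_zero),
    one_smul, mul_zero, add_zero] at hhalf
  rw [setIntegral_subgraph hf.continuous, hhalf]
  simp

lemma integral_subgraph_fderiv_fst (hg : ContDiff ℝ 1 g) (hgc : HasCompactSupport g)
    (hf : ContDiff ℝ 1 f) :
    ∫ p in {p : ℝ × ℝ | p.2 < f p.1}, fderiv ℝ g p (1, 0) = -∫ s, deriv f s • g (s, f s) := by
  have hG := contDiff_comp_shear hg hf
  have hGc := hgc.comp_homeomorph (shear f hf.continuous)
  have hf' : Continuous (deriv f) := hf.continuous_deriv le_rfl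
  have hfst : Integrable fun q => fderiv ℝ (g ∘ shear f hf.continuous) q (1, 0) :=
    integrable_fderiv_apply_of_hasCompactSupport hG hGc _
  have hsnd : Integrable fun q : ℝ × ℝ =>
      deriv f q.1 • fderiv ℝ (g ∘ shear f hf.continuous) q (0, 1) :=
    ((hf'.comp continuous_fst).smul
      (continuous_fderiv_apply_const hG _)).integrable_of_hasCompactSupport
      (hGc.fderiv_apply ℝ (0, 1)).smul_left
  have hpointwise : ∀ q : ℝ × ℝ, fderiv ℝ g (shear f hf.continuous q) (1, 0) =
      fderiv ℝ (g ∘ shear f hf.continuous) q (1, 0) -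
        deriv f q.1 • fderiv ℝ (g ∘ shear f hf.continuous) q (0, 1) := by
    intro q
    have hg' := hg.differentiable one_ne_zero
    have hf' := hf.differentiable one_ne_zero
    rw [fderiv_comp_shear hg' hf', fderiv_comp_shear hg' hf', ← map_smul, ← map_sub]
    congr 1
    ext <;> simp
  simp_rw [setIntegral_subgraph hf.continuous, hpointwise]
  rw [integral_sub hfst.integrableOn hsnd.integrableOn, integral_lowerHalfPlane_fderiv_fst hG hGc,
    integral_lowerHalfPlane_smul_fderiv_snd hG hGc hf', zero_sub]
  simp

end Subgraph

lemma fderiv_comp_planeCoord_coord (e : Plane ≃ₗᵢ[ℝ] Plane) {T : Plane → Plane}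
    (hT : Differentiable ℝ T) (i : Fin 2) (p v : ℝ × ℝ) :
    fderiv ℝ (fun p => (e (T (planeCoord e p))) i) p v =
      (e (fderiv ℝ T (planeCoord e p) (planeCoord e v))) i :=
  congrArg (· v) (((EuclideanSpace.proj (𝕜 := ℝ) i).comp
    (e.toContinuousLinearEquiv : Plane →L[ℝ] Plane)).hasFDerivAt.comp p
      ((hT (planeCoord e p)).hasFDerivAt.comp p
        (planeCoord e : ℝ × ℝ →L[ℝ] Plane).hasFDerivAt)).fderiv

lemma integral_planeDiv_of_tsupport_subset {Ω : Set Plane} {T : Plane → Plane}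
    (hT : ContDiff ℝ 1 T) (hTc : HasCompactSupport T) (hTΩ : tsupport T ⊆ Ω) :
    ∫ x in Ω, planeDiv T x = 0 := by
  rw [setIntegral_eq_integral_of_forall_compl_eq_zero fun x hx =>
    planeDiv_of_notMem_tsupport fun h => hx (hTΩ h)]
  exact integral_planeDiv_eq_zero (hT.differentiable one_ne_zero)
    (hT.continuous.integrable_of_hasCompactSupport hTc)
    (integrable_fderiv_apply_of_hasCompactSupport hT hTc)

namespace IsGraphChart

variable {Ω U : Set Plane} {e : Plane ≃ₗᵢ[ℝ] Plane} {f : ℝ → ℝ} {T : Plane → Plane}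

lemma setIntegral_planeDiv_eq_subgraph (h : IsGraphChart Ω U e f) (hΩ : IsOpen Ω)
    (hT : Differentiable ℝ T) (hTU : tsupport T ⊆ U) :
    ∫ x in Ω, planeDiv T x = ∫ p in {p : ℝ × ℝ | p.2 < f p.1},
      (fderiv ℝ (fun p => (e (T (planeCoord e p))) 0) p (1, 0) +
        fderiv ℝ (fun p => (e (T (planeCoord e p))) 1) p (0, 1)) := by
  have hmeas : MeasurableSet {p : ℝ × ℝ | p.2 < f p.1} :=
    measurableSet_lt measurable_snd (h.contDiff.continuous.measurable.comp measurable_fst)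
  rw [← integral_indicator hΩ.measurableSet, ← (measurePreserving_planeCoord e).integral_comp
    (measurableEmbedding_planeCoord e), ← integral_indicator hmeas]
  refine integral_congr_ae (Eventually.of_forall fun p => ?_)
  classical
  simp only [Set.indicator_apply, fderiv_comp_planeCoord_coord e hT, ← planeDiv_eq_isometry]
  by_cases hp : planeCoord e p ∈ U
  · simp [h.mem_iff _ hp]
  · simp [planeDiv_of_notMem_tsupport fun hx => hp (hTU hx)]

lemma setIntegral_planeDiv (h : IsGraphChart Ω U e f) (hΩ : IsOpen Ω)
    (hT : ContDiff ℝ 1 T) (hTc : HasCompactSupport T) (hTU : tsupport T ⊆ U) :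
    ∫ x in Ω, planeDiv T x = ∫ y in frontier Ω, inner ℝ (T y) (chartNormal e f y) ∂μH[1] := by
  have hf : ContDiff ℝ 1 f := h.contDiff_two.of_le one_le_two
  set S : Fin 2 → ℝ × ℝ → ℝ := fun i p => (e (T (planeCoord e p))) i
  have hS : ∀ i, ContDiff ℝ 1 (S i) := fun i =>
    (contDiff_coord e i).comp (hT.comp (planeCoord e).contDiff)
  have hSc : ∀ i, HasCompactSupport (S i) := fun i =>
    (hTc.comp_homeomorph (planeCoord e).toHomeomorph).comp_left (g := fun z => (e z) i) (by simp)
  have hgraph : Continuous fun s => (s, f s) := continuous_id.prodMk hf.continuous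
  have hSgraph : ∀ i, Continuous fun s => S i (s, f s) := fun i =>
    (hS i).continuous.comp hgraph
  have hSgraphc : ∀ i, HasCompactSupport fun s => S i (s, f s) := fun i =>
    hasCompactSupport_comp_of_leftInverse (hSc i) (fun _ => rfl) continuous_fst hgraph
  have hint : ∀ i v, Integrable fun p => fderiv ℝ (S i) p v := fun i =>
    integrable_fderiv_apply_of_hasCompactSupport (hS i) (hSc i)
  have hint0 : Integrable fun s => deriv f s • S 0 (s, f s) :=
    ((hf.continuous_deriv le_rfl).smul (hSgraph 0)).integrable_of_hasCompactSupport
      (hSgraphc 0).smul_left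
  have hint1 : Integrable fun s => S 1 (s, f s) :=
    (hSgraph 1).integrable_of_hasCompactSupport (hSgraphc 1)
  rw [h.setIntegral_planeDiv_eq_subgraph hΩ (hT.differentiable one_ne_zero) hTU,
    integral_add (hint 0 _).integrableOn (hint 1 _).integrableOn,
    integral_subgraph_fderiv_fst (hS 0) (hSc 0) hf,
    integral_subgraph_fderiv_snd (hS 1) (hSc 1) hf, neg_add_eq_sub, ← integral_sub hint1 hint0,
    h.setIntegral_frontier hΩ fun y hy => by
      rw [image_eq_zero_of_notMem_tsupport fun hyT => hy (hTU hyT), inner_zero_left]]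
  refine integral_congr_ae (Eventually.of_forall fun s => ?_)
  have hnormal := graphSpeed_mul_inner_chartNormal e f (graphCurve e f s) (T (graphCurve e f s))
  rw [apply_graphCurve_zero] at hnormal
  simp only [real_inner_comm (chartNormal e f _), hnormal, smul_eq_mul]
  rfl

end IsGraphChart

/-- A partition of unity on the closure of `Ω` which consists of one function supported in `Ω` and
of finitely many functions supported in graph charts along the boundary. -/
structure ChartPartition (Ω : Set Plane) (ι : Type*) [Fintype ι] where
  /-- the open set on which the chart `i` describes `Ω` -/
  domain : ι → Set Plane
  /-- the Cartesian coordinates of the chart `i` -/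
  coord : ι → Plane ≃ₗᵢ[ℝ] Plane
  /-- the function whose strict subgraph is `Ω` in the chart `i` -/
  height : ι → ℝ → ℝ
  isGraphChart : ∀ i, IsGraphChart Ω (domain i) (coord i) (height i)
  /-- the function of the partition supported in `Ω` -/
  interiorWeight : Plane → ℝ
  contDiff_interiorWeight : ContDiff ℝ 1 interiorWeight
  hasCompactSupport_interiorWeight : HasCompactSupport interiorWeight
  tsupport_interiorWeight_subset : tsupport interiorWeight ⊆ Ω
  /-- the function of the partition supported in the chart `i` -/
  weight : ι → Plane → ℝ
  contDiff_weight : ∀ i, ContDiff ℝ 1 (weight i)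
  hasCompactSupport_weight : ∀ i, HasCompactSupport (weight i)
  tsupport_weight_subset : ∀ i, tsupport (weight i) ⊆ domain i
  weight_nonneg : ∀ i x, 0 ≤ weight i x
  sum_weight_le_one : ∀ x, ∑ i, weight i x ≤ 1
  interiorWeight_add_sum : ∀ x ∈ closure Ω, interiorWeight x + ∑ i, weight i x = 1

open scoped Manifold in
lemma IsRegularSet.exists_chartPartition {Ω : Set Plane} (hΩ : IsRegularSet Ω) :
    ∃ t : Finset (frontier Ω), Nonempty (ChartPartition Ω t) := by
  choose r e f hr hchart using fun x : frontier Ω => hΩ.exists_isGraphChart x.2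
  obtain ⟨t, hcover⟩ := hΩ.isCompact_frontier.elim_finite_subcover
    (fun x : frontier Ω => Metric.ball (x : Plane) (r x)) (fun _ => Metric.isOpen_ball)
    fun x hx => Set.mem_iUnion.2 ⟨⟨x, hx⟩, Metric.mem_ball_self (hr _)⟩
  let V : Option t → Set Plane := fun o => o.elim Ω fun x => Metric.ball x (r x)
  have hVopen : ∀ o, IsOpen (V o)
    | none => hΩ.isOpen
    | some _ => Metric.isOpen_ball
  have hVbounded : ∀ o, Bornology.IsBounded (V o)
    | none => hΩ.isBounded
    | some _ => Metric.isBounded_ball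
  have hVcover : closure Ω ⊆ ⋃ o, V o := by
    rw [closure_eq_self_union_frontier, Set.iUnion_option]
    refine Set.union_subset_union_right Ω (hcover.trans ?_)
    exact Set.iUnion₂_subset fun x hx => Set.subset_iUnion (V ∘ some) ⟨x, hx⟩
  obtain ⟨ρ, hρ⟩ :=
    SmoothPartitionOfUnity.exists_isSubordinate 𝓘(ℝ, Plane) isClosed_closure V hVopen hVcover
  have hsmooth : ∀ o, ContDiff ℝ 1 (ρ o) := fun o =>
    (ρ o).contMDiff.contDiff.of_le (by norm_cast)
  have hcompact : ∀ o, HasCompactSupport (ρ o) := fun o =>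
    Metric.isCompact_of_isClosed_isBounded (isClosed_tsupport _) ((hVbounded o).subset (hρ o))
  have hsum : ∀ x, ∑ᶠ o, ρ o x = ρ none x + ∑ i : t, ρ (some i) x := fun x => by
    rw [finsum_eq_sum_of_fintype, Fintype.sum_option]
  exact ⟨t, ⟨{
    domain := fun x => Metric.ball x (r x)
    coord := fun x => e x
    height := fun x => f x
    isGraphChart := fun x => hchart x
    interiorWeight := ρ none
    contDiff_interiorWeight := hsmooth none
    hasCompactSupport_interiorWeight := hcompact none
    tsupport_interiorWeight_subset := hρ none
    weight := fun x => ρ (some x)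
    contDiff_weight := fun x => hsmooth (some x)
    hasCompactSupport_weight := fun x => hcompact (some x)
    tsupport_weight_subset := fun x => hρ (some x)
    weight_nonneg := fun x => ρ.nonneg (some x)
    sum_weight_le_one := fun x =>
      (le_add_of_nonneg_left (ρ.nonneg none x)).trans ((hsum x).symm.trans_le (ρ.sum_le_one x))
    interiorWeight_add_sum := fun x hx => (hsum x).symm.trans (ρ.sum_eq_one hx) }⟩⟩

/-- A compactly supported `C¹` vector field of norm at most one which on the boundary of `Ω` is the
outer unit normal. -/
structure IsNormalField (Ω : Set Plane) (n : Plane → Plane) : Prop where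
  contDiff : ContDiff ℝ 1 n
  hasCompactSupport : HasCompactSupport n
  norm_le_one : ∀ x, ‖n x‖ ≤ 1
  eq_chartNormal : ∀ {y U e f}, y ∈ frontier Ω → IsGraphChart Ω U e f → y ∈ U →
    n y = chartNormal e f y

namespace ChartPartition

variable {Ω : Set Plane} {ι : Type*} [Fintype ι] (P : ChartPartition Ω ι)

include P

lemma sum_weight_eq_one (hΩ : IsOpen Ω) {y : Plane} (hy : y ∈ frontier Ω) :
    ∑ i, P.weight i y = 1 := by
  have hinterior : P.interiorWeight y = 0 := by
    rw [hΩ.frontier_eq] at hy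
    exact image_eq_zero_of_notMem_tsupport fun h => hy.2 (P.tsupport_interiorWeight_subset h)
  simpa [hinterior] using P.interiorWeight_add_sum y (frontier_subset_closure hy)

lemma isNormalField (hΩ : IsOpen Ω) :
    IsNormalField Ω fun x => ∑ i, P.weight i x • chartNormal (P.coord i) (P.height i) x where
  contDiff := ContDiff.sum fun i _ => (P.contDiff_weight i).smul
    ((contDiff_chartNormal (P.coord i) (P.isGraphChart i).contDiff_deriv).of_le (by norm_cast))
  hasCompactSupport := by
    refine HasCompactSupport.intro
      (isCompact_iUnion fun i => (P.hasCompactSupport_weight i).isCompact) fun x hx => ?_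
    refine Finset.sum_eq_zero fun i _ => ?_
    rw [image_eq_zero_of_notMem_tsupport fun h => hx (Set.mem_iUnion.2 ⟨i, h⟩), zero_smul]
  norm_le_one x := by
    refine (norm_sum_le _ _).trans ((Finset.sum_le_sum fun i _ => ?_).trans
      (P.sum_weight_le_one x))
    rw [norm_smul, norm_chartNormal, mul_one, Real.norm_of_nonneg (P.weight_nonneg i x)]
  eq_chartNormal {y U e f} hy h hyU := by
    have hnormal : ∀ i, P.weight i y • chartNormal (P.coord i) (P.height i) y =
        P.weight i y • chartNormal e f y := by
      intro i
      by_cases hyi : y ∈ tsupport (P.weight i)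
      · rw [(P.isGraphChart i).chartNormal_eq h hΩ (P.tsupport_weight_subset i hyi) hyU hy]
      · rw [image_eq_zero_of_notMem_tsupport hyi, zero_smul, zero_smul]
    simp only [hnormal, ← Finset.sum_smul, P.sum_weight_eq_one hΩ hy, one_smul]

lemma planeDiv_eq (hΩ : IsOpen Ω) {T : Plane → Plane} (hT : ContDiff ℝ 1 T) {x : Plane}
    (hx : x ∈ Ω) :
    planeDiv T x = planeDiv (P.interiorWeight • T) x + ∑ i, planeDiv (P.weight i • T) x := by
  have hinterior : DifferentiableAt ℝ (P.interiorWeight • T) x :=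
    (P.contDiff_interiorWeight.smul hT).differentiable one_ne_zero x
  have hweight : ∀ i, DifferentiableAt ℝ (P.weight i • T) x := fun i =>
    ((P.contDiff_weight i).smul hT).differentiable one_ne_zero x
  have hlocal : T =ᶠ[𝓝 x] P.interiorWeight • T + fun z => ∑ i, (P.weight i • T) z := by
    filter_upwards [hΩ.mem_nhds hx] with z hz
    simp only [Pi.add_apply, Pi.smul_apply', ← Finset.sum_smul, ← add_smul,
      P.interiorWeight_add_sum z (subset_closure hz), one_smul]
  calc planeDiv T x
      = planeDiv (P.interiorWeight • T + fun z => ∑ i, (P.weight i • T) z) x := by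
        simp only [planeDiv, hlocal.fderiv_eq]
    _ = _ := by
        rw [planeDiv_add hinterior (DifferentiableAt.fun_sum fun i _ => hweight i),
          planeDiv_sum _ hweight]

lemma setIntegral_planeDiv_weight_smul (hΩ : IsOpen Ω) {n : Plane → Plane}
    (hn : IsNormalField Ω n) {T : Plane → Plane} (hT : ContDiff ℝ 1 T) (i : ι) :
    ∫ x in Ω, planeDiv (P.weight i • T) x =
      ∫ y in frontier Ω, P.weight i y * inner ℝ (T y) (n y) ∂μH[1] := by
  rw [(P.isGraphChart i).setIntegral_planeDiv hΩ ((P.contDiff_weight i).smul hT)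
    (P.hasCompactSupport_weight i).smul_right
    ((tsupport_smul_subset_left _ T).trans (P.tsupport_weight_subset i))]
  refine setIntegral_congr_fun isClosed_frontier.measurableSet fun y hy => ?_
  by_cases hyi : y ∈ tsupport (P.weight i)
  · simp only [hn.eq_chartNormal hy (P.isGraphChart i) (P.tsupport_weight_subset i hyi),
      Pi.smul_apply', real_inner_smul_left]
  · simp only [Pi.smul_apply', image_eq_zero_of_notMem_tsupport hyi, zero_smul, inner_zero_left,
      zero_mul]

end ChartPartition

namespace IsNormalField

variable {Ω : Set Plane} {n : Plane → Plane}

lemma norm_eq_one (hn : IsNormalField Ω n) (hΩ : IsRegularSet Ω) {y : Plane}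
    (hy : y ∈ frontier Ω) : ‖n y‖ = 1 := by
  obtain ⟨r, e, f, hr, h⟩ := hΩ.exists_isGraphChart hy
  rw [hn.eq_chartNormal hy h (Metric.mem_ball_self hr), norm_chartNormal]

lemma exists_isParabolicTangent (hn : IsNormalField Ω n) (hΩ : IsRegularSet Ω) :
    ∃ C, 0 ≤ C ∧ ∀ y ∈ frontier Ω, IsParabolicTangent Ω y (n y) C := by
  suffices hlocal : ∃ C, ∀ y ∈ frontier Ω, y ∈ frontier Ω → IsParabolicTangent Ω y (n y) C by
    obtain ⟨C, hC⟩ := hlocal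
    exact ⟨|C|, abs_nonneg C, fun y hy => (hC y hy hy).mono (le_abs_self C)⟩
  refine hΩ.isCompact_frontier.induction_on
    (p := fun s => ∃ C, ∀ y ∈ s, y ∈ frontier Ω → IsParabolicTangent Ω y (n y) C)
    ⟨0, by simp⟩ (fun s t hst ⟨C, hC⟩ => ⟨C, fun y hy => hC y (hst hy)⟩) ?_ ?_
  · rintro s t ⟨C, hC⟩ ⟨D, hD⟩
    refine ⟨max C D, ?_⟩
    rintro y (hy | hy) hyΩ
    · exact (hC y hy hyΩ).mono (le_max_left _ _)
    · exact (hD y hy hyΩ).mono (le_max_right _ _)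
  · intro x hx
    obtain ⟨r, e, f, hr, h⟩ := hΩ.exists_isGraphChart hx
    obtain ⟨C, hC⟩ := h.exists_isParabolicTangent hΩ.isOpen (Metric.mem_ball_self hr)
    refine ⟨_, mem_nhdsWithin_of_mem_nhds (inter_mem hC (Metric.ball_mem_nhds x hr)), C, ?_⟩
    rintro y ⟨hy, hyU⟩ hyΩ
    rw [hn.eq_chartNormal hyΩ h hyU]
    exact hy hyΩ

end IsNormalField

namespace IsRegularSet

variable {Ω : Set Plane}

lemma exists_isNormalField (hΩ : IsRegularSet Ω) : ∃ n, IsNormalField Ω n :=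
  let ⟨_, ⟨P⟩⟩ := hΩ.exists_chartPartition
  ⟨_, P.isNormalField hΩ.isOpen⟩

variable {n T : Plane → Plane}

lemma setIntegral_planeDiv (hΩ : IsRegularSet Ω) (hn : IsNormalField Ω n)
    (hT : ContDiff ℝ 1 T) :
    ∫ x in Ω, planeDiv T x = ∫ y in frontier Ω, inner ℝ (T y) (n y) ∂μH[1] := by
  obtain ⟨t, ⟨P⟩⟩ := hΩ.exists_chartPartition
  have hint : ∀ {S : Plane → Plane}, ContDiff ℝ 1 S → IntegrableOn (planeDiv S) Ω := fun hS =>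
    ((continuous_planeDiv hS).continuousOn.integrableOn_compact
      hΩ.isBounded.isCompact_closure).mono_set subset_closure
  have hinterior : ContDiff ℝ 1 (P.interiorWeight • T) := P.contDiff_interiorWeight.smul hT
  have hweight : ∀ i, ContDiff ℝ 1 (P.weight i • T) := fun i => (P.contDiff_weight i).smul hT
  have hinterior_zero : ∫ x in Ω, planeDiv (P.interiorWeight • T) x = 0 :=
    integral_planeDiv_of_tsupport_subset hinterior
      P.hasCompactSupport_interiorWeight.smul_right
      ((tsupport_smul_subset_left _ T).trans P.tsupport_interiorWeight_subset)
  have hboundary : ∀ i, IntegrableOn (fun y => P.weight i y * inner ℝ (T y) (n y))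
      (frontier Ω) μH[1] := fun i => hΩ.integrableOn_frontier
    ((P.contDiff_weight i).continuous.mul
      (hT.continuous.inner hn.contDiff.continuous)).continuousOn
  rw [setIntegral_congr_fun hΩ.isOpen.measurableSet fun x hx => P.planeDiv_eq hΩ.isOpen hT hx,
    integral_add (hint hinterior) (integrable_finsetSum _ fun i _ => hint (hweight i)),
    integral_finsetSum _ fun i _ => hint (hweight i), hinterior_zero, zero_add]
  simp only [P.setIntegral_planeDiv_weight_smul hΩ.isOpen hn hT]
  rw [← integral_finsetSum _ fun i _ => hboundary i]
  refine setIntegral_congr_fun isClosed_frontier.measurableSet fun y hy => ?_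
  simp only [← Finset.sum_mul, P.sum_weight_eq_one hΩ.isOpen hy, one_mul]

lemma setIntegral_compl_planeDiv (hΩ : IsRegularSet Ω) (hn : IsNormalField Ω n)
    (hT : ContDiff ℝ 1 T) (hTi : Integrable T) (hT' : ∀ v, Integrable fun x => fderiv ℝ T x v) :
    ∫ x in Ωᶜ, planeDiv T x = -∫ y in frontier Ω, inner ℝ (T y) (n y) ∂μH[1] := by
  have hsplit := integral_add_compl hΩ.isOpen.measurableSet (integrable_planeDiv hT')
  rw [integral_planeDiv_eq_zero (hT.differentiable one_ne_zero) hTi hT',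
    hΩ.setIntegral_planeDiv hn hT] at hsplit
  linarith

lemma perimeter_eq (hΩ : IsRegularSet Ω) : perimeter Ω = μH[1] (frontier Ω) := by
  obtain ⟨n, hn⟩ := hΩ.exists_isNormalField
  have hfinite := hΩ.isFiniteMeasure_frontier
  have hone : ENNReal.ofReal (∫ _ in frontier Ω, (1 : ℝ) ∂μH[1]) = μH[1] (frontier Ω) := by
    simp [Measure.real, ENNReal.ofReal_toReal hΩ.hausdorffMeasure_frontier_lt_top.ne]
  rw [← hone]
  apply le_antisymm
  · refine iSup₂_le fun T ⟨hT, _, hT1⟩ => ?_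
    rw [hΩ.setIntegral_planeDiv hn hT]
    refine ENNReal.ofReal_le_ofReal (integral_mono (hΩ.integrableOn_frontier
      (hT.continuous.inner hn.contDiff.continuous).continuousOn) (integrable_const _)
      fun y => ?_)
    exact (real_inner_le_norm _ _).trans
      (mul_le_one₀ (hT1 y) (norm_nonneg _) (hn.norm_le_one y))
  · refine le_of_eq_of_le ?_ (le_iSup₂_of_le n
      ⟨hn.contDiff, hn.hasCompactSupport, hn.norm_le_one⟩ le_rfl)
    rw [hΩ.setIntegral_planeDiv hn hn.contDiff]
    congr 1
    refine setIntegral_congr_fun isClosed_frontier.measurableSet fun y hy => ?_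
    simp only [real_inner_self_eq_norm_sq, hn.norm_eq_one hΩ hy, one_pow]

end IsRegularSet

/-! ### The flux kernel -/

lemma yukawa_neg (a : ℝ) (z : Plane) : yukawa a (-z) = yukawa a z := by
  simp only [yukawa, norm_neg]

lemma yukawa_nonneg (a : ℝ) (z : Plane) : 0 ≤ yukawa a z := by
  unfold yukawa
  positivity

lemma integrable_yukawa {a : ℝ} (ha : 0 < a) : Integrable (yukawa a) := by
  refine (integrable_fun_norm_addHaar (volume : Measure Plane)
    (f := fun r : ℝ => Real.exp (-(a * r)) / r)).2 ?_
  refine (integrableOn_exp_mul_Ioi (neg_lt_zero.2 ha) 0).congr_fun (fun r (hr : 0 < r) => ?_)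
    measurableSet_Ioi
  simp only [finrank_euclideanSpace, Fintype.card_fin, smul_eq_mul]
  field_simp
  norm_num

/-- The boundary flux density of the potential of `yukawa a`: the component along `-n` of the
radial field `z ↦ (e^{-a|z|} / (a |z|²)) z`, whose divergence is `-yukawa a` away from `0`. -/
noncomputable def fluxKernel (a : ℝ) (n z : Plane) : ℝ :=
  -(inner ℝ n z) / ‖z‖ ^ 2 * Real.exp (-(a * ‖z‖)) / a

lemma abs_fluxKernel_le {a : ℝ} (ha : 0 < a) (n z : Plane) :
    |fluxKernel a n z| ≤ ‖n‖ * (yukawa a z / a) := by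
  rcases eq_or_ne z 0 with rfl | hz
  · simp [fluxKernel, yukawa]
  have : 0 < ‖z‖ := norm_pos_iff.2 hz
  calc |fluxKernel a n z|
      = |inner ℝ n z| / ‖z‖ ^ 2 * Real.exp (-(a * ‖z‖)) / a := by
        rw [fluxKernel, abs_div, abs_mul, abs_div, abs_neg, abs_of_pos ha, Real.abs_exp,
          abs_of_nonneg (sq_nonneg ‖z‖)]
    _ ≤ ‖n‖ * ‖z‖ / ‖z‖ ^ 2 * Real.exp (-(a * ‖z‖)) / a := by
        gcongr
        exact abs_real_inner_le_norm n z
    _ = ‖n‖ * (yukawa a z / a) := by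
        rw [yukawa]
        field_simp

lemma measurable_fluxKernel (a : ℝ) :
    Measurable fun p : Plane × Plane => fluxKernel a p.1 p.2 := by
  unfold fluxKernel
  fun_prop

lemma integrable_fluxKernel {a : ℝ} (ha : 0 < a) (n : Plane) : Integrable (fluxKernel a n) :=
  (((integrable_yukawa ha).div_const a).const_mul ‖n‖).mono'
    ((measurable_fluxKernel a).comp measurable_prodMk_left).aestronglyMeasurable
    (Eventually.of_forall (abs_fluxKernel_le ha n))

lemma mul_sin_neg_iff {r θ : ℝ} (hr : 0 < r) (hθ : θ ∈ Set.Ioo (-Real.pi) Real.pi) :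
    r * Real.sin θ < 0 ↔ θ < 0 := by
  rw [← not_iff_not, not_lt, not_lt, mul_nonneg_iff_of_pos_left hr]
  refine ⟨fun h => ?_, fun h => Real.sin_nonneg_of_nonneg_of_le_pi h hθ.2.le⟩
  contrapose! h
  exact Real.sin_neg_of_neg_of_neg_pi_lt h hθ.1

lemma integral_indicator_Iio_neg_sin :
    ∫ θ in Set.Ioo (-Real.pi) Real.pi, (Set.Iio 0).indicator (fun θ => -Real.sin θ) θ = 2 := by
  rw [setIntegral_indicator measurableSet_Iio, Set.Ioo_inter_Iio,
    min_eq_right Real.pi_pos.le, ← integral_Ioc_eq_integral_Ioo,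
    ← intervalIntegral.integral_of_le (neg_nonpos.2 Real.pi_pos.le),
    intervalIntegral.integral_neg, integral_sin, Real.cos_neg, Real.cos_pi, Real.cos_zero]
  norm_num

lemma norm_planeCoord_polarCoord_symm (e : Plane ≃ₗᵢ[ℝ] Plane) {r : ℝ} (hr : 0 ≤ r) (θ : ℝ) :
    ‖planeCoord e (polarCoord.symm (r, θ))‖ = r := by
  rw [norm_planeCoord]
  simp only [polarCoord_symm_apply, mul_pow, ← mul_add, Real.cos_sq_add_sin_sq, mul_one]
  exact Real.sqrt_sq hr

lemma measurableSet_halfPlane (n : Plane) : MeasurableSet {z : Plane | inner ℝ n z < 0} :=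
  measurableSet_lt (by fun_prop) measurable_const

lemma setIntegral_halfPlane_fluxKernel {a : ℝ} (ha : 0 < a) {n : Plane} (hn : ‖n‖ = 1) :
    ∫ z in {z | inner ℝ n z < 0}, fluxKernel a n z = 2 / a ^ 2 := by
  obtain ⟨e, he⟩ := exists_isometry_apply_one_eq_inner hn
  have hpolar : ∀ p ∈ polarCoord.target, p.1 • {z : Plane | inner ℝ n z < 0}.indicator
      (fluxKernel a n) (planeCoord e (polarCoord.symm p)) =
      (Real.exp (-a * p.1) / a) * (Set.Iio 0).indicator (fun θ => -Real.sin θ) p.2 := by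
    rintro ⟨r, θ⟩ ⟨hr, hθ⟩
    rw [Set.mem_Ioi] at hr
    have hinner : inner ℝ n (planeCoord e (polarCoord.symm (r, θ))) = r * Real.sin θ := by
      rw [← he, apply_planeCoord_one, polarCoord_symm_apply]
    simp only [Set.indicator_apply, Set.mem_ofPred_eq, hinner, mul_sin_neg_iff hr hθ,
      Set.mem_Iio, smul_eq_mul, fluxKernel, norm_planeCoord_polarCoord_symm e hr.le]
    split_ifs
    · field_simp
    · ring
  rw [← integral_indicator (measurableSet_halfPlane n),
    ← (measurePreserving_planeCoord e).integral_comp (measurableEmbedding_planeCoord e),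
    ← integral_comp_polarCoord_symm,
    setIntegral_congr_fun polarCoord.open_target.measurableSet hpolar, polarCoord_target,
    Measure.volume_eq_prod, setIntegral_prod_mul (fun r => Real.exp (-a * r) / a)
      ((Set.Iio 0).indicator fun θ => -Real.sin θ), integral_indicator_Iio_neg_sin,
    integral_div, integral_exp_mul_Ioi (neg_lt_zero.2 ha), mul_zero, Real.exp_zero]
  field_simp

/-! ### The potential of the complement as a boundary flux -/

section RadialField

variable {E : Type*} [NormedAddCommGroup E] [InnerProductSpace ℝ E] {g : ℝ → ℝ}

/-- The radial vector field `z ↦ g(|z|²) z`. The profile is a function of `|z|²` so that its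
smoothness is inherited by the field at the origin. -/
def radialField (g : ℝ → ℝ) (z : E) : E := g (‖z‖ ^ 2) • z

lemma contDiff_radialField {k : WithTop ℕ∞} (hg : ContDiff ℝ k g) :
    ContDiff ℝ k (radialField g : E → E) :=
  (hg.comp (contDiff_norm_sq ℝ)).smul contDiff_id

lemma fderiv_radialField {z : E} (hg : DifferentiableAt ℝ g (‖z‖ ^ 2)) (v : E) :
    fderiv ℝ (radialField g) z v =
      g (‖z‖ ^ 2) • v + (deriv g (‖z‖ ^ 2) * (2 * inner ℝ z v)) • z := by
  have hprofile := hg.hasDerivAt.comp_hasFDerivAt z (hasStrictFDerivAt_norm_sq z).hasFDerivAt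
  have hfield : fderiv ℝ (radialField g) z = _ := (hprofile.smul (hasFDerivAt_id z)).fderiv
  simp [hfield]

lemma norm_fderiv_radialField_le {z : E} (hg : DifferentiableAt ℝ g (‖z‖ ^ 2)) (v : E) :
    ‖fderiv ℝ (radialField g) z v‖ ≤
      (|g (‖z‖ ^ 2)| + 2 * ‖z‖ ^ 2 * |deriv g (‖z‖ ^ 2)|) * ‖v‖ := by
  rw [fderiv_radialField hg]
  calc ‖g (‖z‖ ^ 2) • v + (deriv g (‖z‖ ^ 2) * (2 * inner ℝ z v)) • z‖
      ≤ |g (‖z‖ ^ 2)| * ‖v‖ + |deriv g (‖z‖ ^ 2)| * (2 * |inner ℝ z v|) * ‖z‖ := by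
        refine (norm_add_le _ _).trans_eq ?_
        simp only [norm_smul, Real.norm_eq_abs, abs_mul, abs_two]
    _ ≤ |g (‖z‖ ^ 2)| * ‖v‖ + |deriv g (‖z‖ ^ 2)| * (2 * (‖z‖ * ‖v‖)) * ‖z‖ := by
        gcongr
        exact abs_real_inner_le_norm z v
    _ = (|g (‖z‖ ^ 2)| + 2 * ‖z‖ ^ 2 * |deriv g (‖z‖ ^ 2)|) * ‖v‖ := by ring

lemma planeDiv_radialField {z : Plane} (hg : DifferentiableAt ℝ g (‖z‖ ^ 2)) :
    planeDiv (radialField g) z = 2 * g (‖z‖ ^ 2) + 2 * ‖z‖ ^ 2 * deriv g (‖z‖ ^ 2) := by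
  have hz : ‖z‖ ^ 2 = z 0 ^ 2 + z 1 ^ 2 := norm_sq_eq_coords (.refl ℝ Plane) z
  simp only [planeDiv, fderiv_radialField hg, Fin.sum_univ_two, inner_plane]
  generalize deriv g (‖z‖ ^ 2) = d
  simp [hz]
  ring

end RadialField

/-- The profile `u ↦ e^{-a√u} / (a u)`, for which `radialField` has divergence `-yukawa a`, cut
off smoothly in `u ≤ ε²`. -/
noncomputable def fluxProfile (a ε u : ℝ) : ℝ :=
  Real.smoothTransition (2 * u / ε ^ 2 - 1) * (Real.exp (-(a * √u)) / (a * u))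

section FluxProfile

variable {a ε u : ℝ}

lemma fluxProfile_eq (hε : 0 < ε) (hu : ε ^ 2 ≤ u) :
    fluxProfile a ε u = Real.exp (-(a * √u)) / (a * u) := by
  have hratio : 1 ≤ u / ε ^ 2 := (one_le_div (by positivity)).2 hu
  rw [fluxProfile, Real.smoothTransition.one_of_one_le, one_mul]
  rw [mul_div_assoc]
  linarith

lemma fluxProfile_eq_zero (hε : 0 < ε) (hu : u ≤ ε ^ 2 / 2) : fluxProfile a ε u = 0 := by
  have hratio : u / ε ^ 2 ≤ 1 / 2 := by
    rw [div_le_iff₀ (by positivity)]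
    linarith
  rw [fluxProfile, Real.smoothTransition.zero_of_nonpos, zero_mul]
  rw [mul_div_assoc]
  linarith

lemma contDiff_fluxProfile (ha : a ≠ 0) (hε : 0 < ε) : ContDiff ℝ 1 (fluxProfile a ε) := by
  refine contDiff_iff_contDiffAt.2 fun u => ?_
  rcases lt_or_ge u (ε ^ 2 / 2) with hu | hu
  · refine (contDiffAt_const (c := (0 : ℝ))).congr_of_eventuallyEq ?_
    filter_upwards [eventually_lt_nhds hu] with v hv using fluxProfile_eq_zero hε hv.le
  · have hu0 : u ≠ 0 := (lt_of_lt_of_le (by positivity) hu).ne'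
    have hcutoff : ContDiff ℝ 1 fun u : ℝ => Real.smoothTransition (2 * u / ε ^ 2 - 1) :=
      (Real.smoothTransition.contDiff (n := 1)).comp (by fun_prop)
    have hexp : ContDiffAt ℝ 1 (fun u : ℝ => Real.exp (-(a * √u))) u :=
      (contDiffAt_const.mul (Real.contDiffAt_sqrt hu0)).neg.exp
    exact hcutoff.contDiffAt.mul
      (hexp.div (contDiffAt_const.mul contDiffAt_id) (mul_ne_zero ha hu0))

lemma deriv_fluxProfile (ha : a ≠ 0) (hε : 0 < ε) (hu : ε ^ 2 < u) :
    deriv (fluxProfile a ε) u =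
      -(Real.exp (-(a * √u)) / (2 * √u * u) + Real.exp (-(a * √u)) / (a * u ^ 2)) := by
  have hu0 : 0 < u := lt_trans (by positivity) hu
  have : 0 < √u := Real.sqrt_pos.2 hu0
  have heq : fluxProfile a ε =ᶠ[𝓝 u] fun u => Real.exp (-(a * √u)) / (a * u) := by
    filter_upwards [eventually_gt_nhds hu] with v hv using fluxProfile_eq hε hv.le
  have hnum := ((Real.hasDerivAt_sqrt hu0.ne').const_mul a).fun_neg.exp
  rw [heq.deriv_eq, (hnum.fun_div ((hasDerivAt_id' u).const_mul a)
    (mul_ne_zero ha hu0.ne')).deriv]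
  field_simp
  ring

end FluxProfile

lemma integrable_of_continuous_of_isBigO_yukawa {E : Type*} [NormedAddCommGroup E]
    {F : Plane → E} (hF : Continuous F) {a : ℝ} (ha : 0 < a)
    (h : F =O[cocompact Plane] yukawa a) : Integrable F :=
  hF.locallyIntegrable.integrable_of_isBigO_cocompact h
    ((integrable_yukawa ha).integrableAtFilter _)

/-- A `C¹` vector field whose divergence is `-yukawa a` outside the ball of radius `ε` around the
origin. -/
noncomputable def fluxField (a ε : ℝ) : Plane → Plane := radialField (fluxProfile a ε)

section FluxField

variable {a ε : ℝ} {z : Plane}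

lemma contDiff_fluxField (ha : a ≠ 0) (hε : 0 < ε) : ContDiff ℝ 1 (fluxField a ε) :=
  contDiff_radialField (contDiff_fluxProfile ha hε)

lemma fluxField_eq (hε : 0 < ε) (hz : ε < ‖z‖) :
    fluxField a ε z = (Real.exp (-(a * ‖z‖)) / (a * ‖z‖ ^ 2)) • z := by
  rw [fluxField, radialField, fluxProfile_eq hε (by gcongr), Real.sqrt_sq (norm_nonneg z)]

lemma planeDiv_fluxField (ha : a ≠ 0) (hε : 0 < ε) (hz : ε < ‖z‖) :
    planeDiv (fluxField a ε) z = -yukawa a z := by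
  have hz0 : 0 < ‖z‖ := hε.trans hz
  have hu : ε ^ 2 < ‖z‖ ^ 2 := by gcongr
  rw [fluxField, planeDiv_radialField ((contDiff_fluxProfile ha hε).differentiable one_ne_zero _),
    deriv_fluxProfile ha hε hu, fluxProfile_eq hε hu.le, Real.sqrt_sq hz0.le, yukawa]
  field_simp
  ring

lemma integrable_fluxField (ha : 0 < a) (hε : 0 < ε) : Integrable (fluxField a ε) := by
  refine integrable_of_continuous_of_isBigO_yukawa (contDiff_fluxField ha.ne' hε).continuous ha
    (IsBigO.of_bound (1 / a) ?_)
  filter_upwards [tendsto_norm_cocompact_atTop.eventually_gt_atTop ε] with z hz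
  have hz0 : 0 < ‖z‖ := hε.trans hz
  rw [fluxField_eq hε hz, norm_smul, Real.norm_of_nonneg (by positivity),
    Real.norm_of_nonneg (yukawa_nonneg a z), yukawa]
  apply le_of_eq
  field_simp

lemma norm_fderiv_fluxField_le (ha : 0 < a) (hε : 0 < ε) (hz : ε < ‖z‖) (v : Plane) :
    ‖fderiv ℝ (fluxField a ε) z v‖ ≤ (1 + 3 / (a * ε)) * yukawa a z * ‖v‖ := by
  have hz0 : 0 < ‖z‖ := hε.trans hz
  have hu : ε ^ 2 < ‖z‖ ^ 2 := by gcongr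
  refine (norm_fderiv_radialField_le
    ((contDiff_fluxProfile ha.ne' hε).differentiable one_ne_zero _) v).trans ?_
  gcongr
  rw [deriv_fluxProfile ha.ne' hε hu, fluxProfile_eq hε hu.le, Real.sqrt_sq hz0.le, abs_neg,
    abs_of_nonneg (by positivity), abs_of_nonneg (by positivity)]
  calc _ = (1 + 3 / (a * ‖z‖)) * yukawa a z := by
        rw [yukawa]
        field_simp
        ring
    _ ≤ (1 + 3 / (a * ε)) * yukawa a z := by
        have := yukawa_nonneg a z
        gcongr

lemma integrable_fderiv_fluxField (ha : 0 < a) (hε : 0 < ε) (v : Plane) :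
    Integrable fun z => fderiv ℝ (fluxField a ε) z v := by
  refine integrable_of_continuous_of_isBigO_yukawa
    (continuous_fderiv_apply_const (contDiff_fluxField ha.ne' hε) v) ha
    (IsBigO.of_bound ((1 + 3 / (a * ε)) * ‖v‖) ?_)
  filter_upwards [tendsto_norm_cocompact_atTop.eventually_gt_atTop ε] with z hz
  rw [Real.norm_of_nonneg (yukawa_nonneg a z), mul_right_comm]
  exact norm_fderiv_fluxField_le ha hε hz v

lemma inner_fluxField_sub (hε : 0 < ε) {x y : Plane} (h : ε < ‖y - x‖) (n : Plane) :
    inner ℝ (fluxField a ε (y - x)) n = fluxKernel a n (x - y) := by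
  rw [fluxField_eq hε h, real_inner_smul_left, real_inner_comm, fluxKernel, norm_sub_rev x y,
    ← inner_neg_right, neg_sub]
  ring

end FluxField

/-- The field `y ↦ fluxField a ε (y - x)` has divergence `-yukawa a (x - y)` as soon as the ball of
radius `ε` around `x` lies in `Ω`. -/
lemma IsRegularSet.setIntegral_compl_yukawa {Ω : Set Plane} (hΩ : IsRegularSet Ω)
    {n : Plane → Plane} (hn : IsNormalField Ω n) {a : ℝ} (ha : 0 < a) {x : Plane} (hx : x ∈ Ω) :
    ∫ y in Ωᶜ, yukawa a (x - y) =
      ∫ y in frontier Ω, fluxKernel a (n y) (x - y) ∂μH[1] := by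
  obtain ⟨ε, hε, hball⟩ := Metric.nhds_basis_closedBall.mem_iff.1 (hΩ.isOpen.mem_nhds hx)
  have hfar : ∀ y ∉ Ω, ε < ‖y - x‖ := fun y hy => by
    contrapose! hy
    exact hball (mem_closedBall_iff_norm.2 hy)
  have hfderiv : ∀ y, fderiv ℝ (fun y => fluxField a ε (y - x)) y =
      fderiv ℝ (fluxField a ε) (y - x) := fun y => fderiv_comp_sub x
  have hdivergence := hΩ.setIntegral_compl_planeDiv hn (T := fun y => fluxField a ε (y - x))
    ((contDiff_fluxField ha.ne' hε).comp (contDiff_id.sub contDiff_const))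
    ((integrable_fluxField ha hε).comp_sub_right x) fun v => by
      simp only [hfderiv]
      exact (integrable_fderiv_fluxField ha hε v).comp_sub_right x
  calc ∫ y in Ωᶜ, yukawa a (x - y)
      = -∫ y in Ωᶜ, planeDiv (fun y => fluxField a ε (y - x)) y := by
        rw [← integral_neg]
        refine setIntegral_congr_fun hΩ.isOpen.measurableSet.compl fun y hy => ?_
        rw [show planeDiv (fun y => fluxField a ε (y - x)) y = planeDiv (fluxField a ε) (y - x) by
          simp only [planeDiv, hfderiv], planeDiv_fluxField ha.ne' hε (hfar y hy), neg_neg,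
          ← yukawa_neg, neg_sub]
    _ = ∫ y in frontier Ω, inner ℝ (fluxField a ε (y - x)) (n y) ∂μH[1] := by
        rw [hdivergence, neg_neg]
    _ = ∫ y in frontier Ω, fluxKernel a (n y) (x - y) ∂μH[1] := by
        refine setIntegral_congr_fun isClosed_frontier.measurableSet fun y hy => ?_
        rw [hΩ.isOpen.frontier_eq] at hy
        exact inner_fluxField_sub hε (hfar y hy.2) (n y)

/-! ### The flux defect under parabolic rescaling -/

lemma integral_comp_div_div {E : Type*} [NormedAddCommGroup E] [NormedSpace ℝ E]
    (F : ℝ × ℝ → E) {a b : ℝ} (ha : a ≠ 0) (hb : b ≠ 0) :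
    ∫ p : ℝ × ℝ, F (p.1 / a, p.2 / b) = |a * b| • ∫ q, F q := by
  have hmap : Measure.map (Prod.map (a⁻¹ * ·) (b⁻¹ * ·)) (volume : Measure (ℝ × ℝ)) =
      ENNReal.ofReal |a * b| • volume := by
    rw [Measure.volume_eq_prod, ← Measure.map_prod_map _ _ (measurable_const_mul _)
      (measurable_const_mul _), Real.map_volume_mul_left (inv_ne_zero ha),
      Real.map_volume_mul_left (inv_ne_zero hb), Measure.prod_smul_left,
      Measure.prod_smul_right, smul_smul, inv_inv, inv_inv, abs_mul,
      ENNReal.ofReal_mul (abs_nonneg a)]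
  have hemb : MeasurableEmbedding (Prod.map (a⁻¹ * ·) (b⁻¹ * ·) : ℝ × ℝ → ℝ × ℝ) :=
    ((Homeomorph.mulLeft₀ a⁻¹ (inv_ne_zero ha)).prodCongr
      (Homeomorph.mulLeft₀ b⁻¹ (inv_ne_zero hb))).measurableEmbedding
  have hintegral := hemb.integral_map (μ := volume) F
  rw [hmap, integral_smul_measure, ENNReal.toReal_ofReal (abs_nonneg _)] at hintegral
  rw [hintegral]
  simp only [Prod.map, div_eq_inv_mul]

/-- The difference between the flux of a half plane and that of `Ω` at the boundary point `y`. -/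
noncomputable def fluxDefect (Ω : Set Plane) (a : ℝ) (n y : Plane) : ℝ :=
  2 / a ^ 2 - ∫ x in Ω, fluxKernel a n (x - y)

/-- The flux kernel in the parabolic coordinates `(s / a, t / a²)`, where `t` is the coordinate
along the normal, multiplied by `a`. -/
noncomputable def scaledKernel (a : ℝ) (p : ℝ × ℝ) : ℝ :=
  -p.2 / (p.1 ^ 2 + p.2 ^ 2 / a ^ 2) * Real.exp (-√(p.1 ^ 2 + p.2 ^ 2 / a ^ 2))

/-- The integrand of the flux defect after parabolic rescaling around `y`. -/
noncomputable def scaledDefect (Ω : Set Plane) (y : Plane) (e : Plane ≃ₗᵢ[ℝ] Plane) (a : ℝ)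
    (p : ℝ × ℝ) : ℝ :=
  ((Set.Iio 0).indicator 1 p.2 - Ω.indicator 1 (y + planeCoord e (p.1 / a, p.2 / a ^ 2))) *
    scaledKernel a p

section Rescaling

variable {Ω : Set Plane} {y n : Plane} {e : Plane ≃ₗᵢ[ℝ] Plane} {a : ℝ}

lemma norm_planeCoord_parabolic (e : Plane ≃ₗᵢ[ℝ] Plane) (ha : 0 < a) (p : ℝ × ℝ) :
    ‖planeCoord e (p.1 / a, p.2 / a ^ 2)‖ = √(p.1 ^ 2 + p.2 ^ 2 / a ^ 2) / a := by
  have hscale : (p.1 / a) ^ 2 + (p.2 / a ^ 2) ^ 2 = (p.1 ^ 2 + p.2 ^ 2 / a ^ 2) / a ^ 2 := by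
    field_simp
  rw [norm_planeCoord, hscale, Real.sqrt_div' _ (sq_nonneg a), Real.sqrt_sq ha.le]

lemma mul_fluxKernel_parabolic (he : ∀ z, (e z) 1 = inner ℝ n z) (ha : 0 < a) (p : ℝ × ℝ) :
    a * fluxKernel a n (planeCoord e (p.1 / a, p.2 / a ^ 2)) = scaledKernel a p := by
  have hm : 0 ≤ p.1 ^ 2 + p.2 ^ 2 / a ^ 2 := by positivity
  rw [fluxKernel, scaledKernel, ← he, apply_planeCoord_one, norm_planeCoord_parabolic e ha,
    div_pow, Real.sq_sqrt hm, mul_div_cancel₀ _ ha.ne']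
  field_simp

lemma fluxDefect_eq_integral (hΩ : MeasurableSet Ω) (hn : ‖n‖ = 1) (ha : 0 < a) (y : Plane) :
    fluxDefect Ω a n y = ∫ z, ({z | inner ℝ n z < 0}.indicator 1 z - Ω.indicator 1 (y + z)) *
      fluxKernel a n z := by
  classical
  have hk := integrable_fluxKernel ha n
  have hhalf := measurableSet_halfPlane n
  have hshift : MeasurableSet {z : Plane | y + z ∈ Ω} := hΩ.preimage (measurable_const_add y)
  have htranslate :
      ∫ x in Ω, fluxKernel a n (x - y) = ∫ z in {z | y + z ∈ Ω}, fluxKernel a n z := by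
    rw [← integral_indicator hΩ, ← integral_indicator hshift, ← integral_add_left_eq_self _ y]
    simp only [Set.indicator_apply, Set.mem_ofPred_eq, add_sub_cancel_left]
  rw [fluxDefect, htranslate, ← setIntegral_halfPlane_fluxKernel ha hn,
    ← integral_indicator hhalf, ← integral_indicator hshift,
    ← integral_sub (hk.indicator hhalf) (hk.indicator hshift)]
  refine integral_congr_ae (Eventually.of_forall fun z => ?_)
  simp only [Set.indicator_apply, Set.mem_ofPred_eq, Pi.one_apply, sub_mul, ite_mul, one_mul,
    zero_mul]

lemma pow_four_mul_fluxDefect (hΩ : MeasurableSet Ω) (hn : ‖n‖ = 1)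
    (he : ∀ z, (e z) 1 = inner ℝ n z) (ha : 0 < a) :
    a ^ 4 * fluxDefect Ω a n y = ∫ p, scaledDefect Ω y e a p := by
  classical
  set G : Plane → ℝ := fun z =>
    ({z | inner ℝ n z < 0}.indicator 1 z - Ω.indicator 1 (y + z)) * fluxKernel a n z
  have hG : ∀ p : ℝ × ℝ, scaledDefect Ω y e a p =
      a * G (planeCoord e (p.1 / a, p.2 / a ^ 2)) := fun p => by
    have hneg : p.2 / a ^ 2 < 0 ↔ p.2 < 0 := by rw [div_lt_iff₀ (by positivity), zero_mul]
    rw [scaledDefect, ← mul_fluxKernel_parabolic he ha, mul_left_comm]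
    simp only [G, Set.indicator_apply, Set.mem_ofPred_eq, Set.mem_Iio, ← he,
      apply_planeCoord_one, hneg, Pi.one_apply]
  calc a ^ 4 * fluxDefect Ω a n y
      = a * (a * a ^ 2 * ∫ q, G (planeCoord e q)) := by
        rw [fluxDefect_eq_integral hΩ hn ha,
          (measurePreserving_planeCoord e).integral_comp (measurableEmbedding_planeCoord e)]
        ring
    _ = a * ∫ p : ℝ × ℝ, G (planeCoord e (p.1 / a, p.2 / a ^ 2)) := by
        rw [integral_comp_div_div (fun q => G (planeCoord e q)) ha.ne' (pow_pos ha 2).ne',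
          abs_of_pos (by positivity), smul_eq_mul]
    _ = ∫ p, scaledDefect Ω y e a p := by
        simp only [hG, integral_const_mul]

lemma measurable_scaledDefect (hΩ : MeasurableSet Ω) (y : Plane) (e : Plane ≃ₗᵢ[ℝ] Plane)
    (a : ℝ) : Measurable (scaledDefect Ω y e a) := by
  have hpoint : Measurable fun p : ℝ × ℝ => y + planeCoord e (p.1 / a, p.2 / a ^ 2) :=
    measurable_const.add ((planeCoord e).continuous.measurable.comp (by fun_prop))
  refine (((measurable_one.indicator measurableSet_Iio).comp measurable_snd).sub
    ((measurable_one.indicator hΩ).comp hpoint)).mul ?_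
  unfold scaledKernel
  fun_prop

end Rescaling

/-! ### Domination of the rescaled defect -/

/-- An integrable majorant, uniform in `a`, of the rescaled defect at a boundary point where `Ω`
lies between two parabolas of opening `C`. The constants come from `m ^ k ≤ k! * exp m`, as
`3 = 1 + 2!` and `744 = 4! + 6!`. -/
noncomputable def defectMajorant (C : ℝ) (p : ℝ × ℝ) : ℝ :=
  C * (3 + 744 * C ^ 2) * ((1 + p.1 ^ 2)⁻¹ * (1 + p.2 ^ 2)⁻¹)

lemma integrable_defectMajorant (C : ℝ) : Integrable (defectMajorant C) :=
  (integrable_inv_one_add_sq.mul_prod integrable_inv_one_add_sq).const_mul _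

lemma one_add_sq_mul_one_add_sq_le_exp {C m u v : ℝ} (hm : 0 ≤ m) (hu : u ^ 2 ≤ m ^ 2)
    (hv : |v| ≤ C * m ^ 2) :
    (1 + u ^ 2) * (1 + v ^ 2) ≤ (3 + 744 * C ^ 2) * Real.exp m := by
  have h2 := Real.pow_div_factorial_le_exp m hm 2
  have h4 := Real.pow_div_factorial_le_exp m hm 4
  have h6 := Real.pow_div_factorial_le_exp m hm 6
  have h0 := Real.one_le_exp hm
  norm_num [Nat.factorial] at h2 h4 h6
  have hv2 : v ^ 2 ≤ (C * m ^ 2) ^ 2 := by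
    rw [← sq_abs v]
    gcongr
  calc (1 + u ^ 2) * (1 + v ^ 2) ≤ (1 + m ^ 2) * (1 + (C * m ^ 2) ^ 2) := by gcongr
    _ = 1 + m ^ 2 + C ^ 2 * m ^ 4 + C ^ 2 * m ^ 6 := by ring
    _ ≤ Real.exp m + 2 * Real.exp m + C ^ 2 * (24 * Real.exp m) +
        C ^ 2 * (720 * Real.exp m) := by gcongr <;> linarith
    _ = (3 + 744 * C ^ 2) * Real.exp m := by ring

/-- The common bound behind the estimates of the rescaled defect, with `M = s² + t² / a²`, and of
its limit, with `M = s²`. -/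
lemma abs_mul_kernel_le_defectMajorant {C M w : ℝ} {p : ℝ × ℝ} (hC : 0 ≤ C) (hM : p.1 ^ 2 ≤ M)
    (hw : |w| ≤ 1) (hw0 : C * M < |p.2| → w = 0) :
    |w * (-p.2 / M * Real.exp (-√M))| ≤ defectMajorant C p := by
  rcases lt_or_ge (C * M) |p.2| with hlt | hle
  · rw [hw0 hlt, zero_mul, abs_zero]
    unfold defectMajorant
    positivity
  have hM0 : 0 ≤ M := (sq_nonneg p.1).trans hM
  have hkernel : |-p.2 / M| ≤ C := by
    rw [abs_div, abs_neg, abs_of_nonneg hM0]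
    exact div_le_of_le_mul₀ hM0 hC hle
  have hexp := one_add_sq_mul_one_add_sq_le_exp (C := C) (u := p.1) (v := p.2)
    (Real.sqrt_nonneg M) (by rwa [Real.sq_sqrt hM0]) (by rwa [Real.sq_sqrt hM0])
  calc |w * (-p.2 / M * Real.exp (-√M))|
      = |w| * (|-p.2 / M| * Real.exp (-√M)) := by rw [abs_mul, abs_mul, Real.abs_exp]
    _ ≤ 1 * (C * Real.exp (-√M)) := by gcongr
    _ ≤ C * ((3 + 744 * C ^ 2) * ((1 + p.1 ^ 2)⁻¹ * (1 + p.2 ^ 2)⁻¹)) := by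
        rw [one_mul]
        gcongr
        rwa [← mul_inv, Real.exp_neg, ← div_eq_mul_inv, le_div_iff₀ (by positivity),
          inv_mul_eq_div, div_le_iff₀ (Real.exp_pos _)]
    _ = defectMajorant C p := by
        rw [defectMajorant]
        ring

lemma abs_indicator_one_sub_indicator_one_le {β γ : Type*} (s : Set β) (t : Set γ) (x : β)
    (y : γ) : |s.indicator (1 : β → ℝ) x - t.indicator (1 : γ → ℝ) y| ≤ 1 := by
  classical
  simp only [Set.indicator_apply, Pi.one_apply]
  split_ifs <;> simp

lemma IsParabolicTangent.abs_scaledDefect_le {Ω : Set Plane} {y n : Plane} {C a : ℝ}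
    {e : Plane ≃ₗᵢ[ℝ] Plane} (ht : IsParabolicTangent Ω y n C) (hC : 0 ≤ C)
    (he : ∀ z, (e z) 1 = inner ℝ n z) (ha : 0 < a) (p : ℝ × ℝ) :
    |scaledDefect Ω y e a p| ≤ defectMajorant C p := by
  set M := p.1 ^ 2 + p.2 ^ 2 / a ^ 2
  have hM : 0 ≤ M := by positivity
  refine abs_mul_kernel_le_defectMajorant hC
    (le_add_of_nonneg_right (by positivity : 0 ≤ p.2 ^ 2 / a ^ 2))
    (abs_indicator_one_sub_indicator_one_le _ _ _ _) fun hlt => ?_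
  obtain ⟨hbelow, habove⟩ := ht (planeCoord e (p.1 / a, p.2 / a ^ 2))
  rw [← he, apply_planeCoord_one, norm_planeCoord_parabolic e ha, div_pow, Real.sq_sqrt hM,
    ← mul_div_assoc, div_lt_div_iff_of_pos_right (by positivity)] at habove
  rw [← he, apply_planeCoord_one, norm_planeCoord_parabolic e ha, div_pow, Real.sq_sqrt hM,
    ← mul_div_assoc, ← neg_div, div_lt_div_iff_of_pos_right (by positivity)] at hbelow
  have hCM : 0 ≤ C * M := by positivity
  rcases lt_abs.1 hlt with hpos | hneg
  · rw [Set.indicator_of_notMem (habove hpos), Set.indicator_of_notMem, sub_zero]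
    exact not_lt.2 (hCM.trans hpos.le)
  · have hlt : p.2 < -(C * M) := lt_neg_of_lt_neg hneg
    rw [Set.indicator_of_mem (hbelow hlt), Set.indicator_of_mem, Pi.one_apply, Pi.one_apply,
      sub_self]
    exact hlt.trans_le (neg_nonpos.2 hCM)

lemma IsParabolicTangent.abs_pow_four_mul_fluxDefect_le {Ω : Set Plane} {y n : Plane} {C a : ℝ}
    (ht : IsParabolicTangent Ω y n C) (hΩ : MeasurableSet Ω) (hn : ‖n‖ = 1) (hC : 0 ≤ C)
    (ha : 0 < a) : |a ^ 4 * fluxDefect Ω a n y| ≤ ∫ p, defectMajorant C p := by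
  obtain ⟨e, he⟩ := exists_isometry_apply_one_eq_inner hn
  rw [pow_four_mul_fluxDefect hΩ hn he ha, ← Real.norm_eq_abs]
  exact norm_integral_le_of_norm_le (integrable_defectMajorant C)
    (Eventually.of_forall (ht.abs_scaledDefect_le hC he ha))

/-! ### The limit of the rescaled defect -/

/-- The limit of the rescaled defect integrand at a boundary point of curvature `c`. -/
noncomputable def limitDefect (c : ℝ) (p : ℝ × ℝ) : ℝ :=
  ((Set.Iio 0).indicator 1 p.2 - (Set.Iio (c / 2 * p.1 ^ 2)).indicator 1 p.2) *
    (-p.2 / p.1 ^ 2 * Real.exp (-|p.1|))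

lemma measurable_limitDefect (c : ℝ) : Measurable (limitDefect c) := by
  have hsubgraph : MeasurableSet {p : ℝ × ℝ | p.2 < c / 2 * p.1 ^ 2} :=
    measurableSet_lt measurable_snd (by fun_prop)
  exact (((measurable_one.indicator measurableSet_Iio).comp measurable_snd).sub
    (measurable_one.indicator hsubgraph)).mul (by fun_prop)

lemma abs_limitDefect_le (c : ℝ) (p : ℝ × ℝ) :
    |limitDefect c p| ≤ defectMajorant (|c| / 2) p := by
  rw [limitDefect, ← Real.sqrt_sq_eq_abs p.1]
  refine abs_mul_kernel_le_defectMajorant (by positivity) le_rfl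
    (abs_indicator_one_sub_indicator_one_le _ _ _ _) fun hlt => ?_
  have hupper : c / 2 * p.1 ^ 2 ≤ |c| / 2 * p.1 ^ 2 := by
    gcongr
    exact le_abs_self c
  have hlower : -(|c| / 2 * p.1 ^ 2) ≤ c / 2 * p.1 ^ 2 := by
    rw [← neg_mul, ← neg_div]
    gcongr
    exact neg_abs_le c
  have hnonneg : 0 ≤ |c| / 2 * p.1 ^ 2 := by positivity
  rcases lt_abs.1 hlt with hpos | hneg
  · rw [Set.indicator_of_notMem (Set.notMem_Iio.2 (hnonneg.trans hpos.le)),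
      Set.indicator_of_notMem (Set.notMem_Iio.2 (hupper.trans hpos.le)), sub_zero]
  · have hlt : p.2 < -(|c| / 2 * p.1 ^ 2) := lt_neg_of_lt_neg hneg
    rw [Set.indicator_of_mem (Set.mem_Iio.2 (hlt.trans_le (neg_nonpos.2 hnonneg))),
      Set.indicator_of_mem (Set.mem_Iio.2 (hlt.trans_le hlower)), sub_self]

lemma integrable_limitDefect (c : ℝ) : Integrable (limitDefect c) :=
  (integrable_defectMajorant _).mono' (measurable_limitDefect c).aestronglyMeasurable
    (Eventually.of_forall (abs_limitDefect_le c))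

lemma integral_indicator_Iio_sub (w : ℝ) :
    ∫ v : ℝ, ((Set.Iio 0).indicator 1 v - (Set.Iio w).indicator 1 v) * -v = w ^ 2 / 2 := by
  classical
  have hprimitive : ∫ v in (0 : ℝ)..w, v = w ^ 2 / 2 := by simp [integral_id]
  rw [← hprimitive]
  rcases le_total 0 w with hw | hw
  · rw [intervalIntegral.integral_of_le hw, integral_Ioc_eq_integral_Ioo,
      ← integral_Ico_eq_integral_Ioo, ← integral_indicator measurableSet_Ico]
    refine integral_congr_ae (Eventually.of_forall fun v => ?_)
    simp only [Set.indicator_apply, Set.mem_Iio, Set.mem_Ico, Pi.one_apply]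
    split_ifs <;> grind
  · rw [intervalIntegral.integral_of_ge hw, integral_Ioc_eq_integral_Ioo,
      ← integral_Ico_eq_integral_Ioo, ← integral_indicator measurableSet_Ico, ← integral_neg]
    refine integral_congr_ae (Eventually.of_forall fun v => ?_)
    simp only [Set.indicator_apply, Set.mem_Iio, Set.mem_Ico, Pi.one_apply]
    split_ifs <;> grind

lemma integral_pow_mul_exp_neg_abs {k : ℕ} (hk : Even k) :
    ∫ u : ℝ, u ^ k * Real.exp (-|u|) = 2 * k.factorial := by
  have hgamma : ∫ u in Set.Ioi (0 : ℝ), u ^ k * Real.exp (-u) = k.factorial := by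
    rw [← Real.Gamma_nat_eq_factorial, Real.Gamma_eq_integral (by positivity)]
    refine setIntegral_congr_fun measurableSet_Ioi fun u _ => ?_
    simp only [add_sub_cancel_right, Real.rpow_natCast, mul_comm]
  rw [← hgamma, ← integral_comp_abs (f := fun u => u ^ k * Real.exp (-u))]
  simp only [hk.pow_abs]

lemma integral_limitDefect (c : ℝ) : ∫ p, limitDefect c p = c ^ 2 / 2 := by
  have hslice : ∀ u : ℝ, ∫ v, limitDefect c (u, v) =
      c ^ 2 / 8 * (u ^ 2 * Real.exp (-|u|)) := fun u => by
    calc ∫ v, limitDefect c (u, v)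
        = (∫ v, ((Set.Iio 0).indicator 1 v - (Set.Iio (c / 2 * u ^ 2)).indicator 1 v) * -v) *
            (Real.exp (-|u|) / u ^ 2) := by
          rw [← integral_mul_const]
          refine integral_congr_ae (Eventually.of_forall fun v => ?_)
          simp only [limitDefect]
          ring
      _ = c ^ 2 / 8 * (u ^ 2 * Real.exp (-|u|)) := by
          rw [integral_indicator_Iio_sub]
          rcases eq_or_ne u 0 with rfl | hu
          · simp
          · field_simp
            ring
  rw [Measure.volume_eq_prod, integral_prod _ (integrable_limitDefect c)]
  simp only [hslice]
  rw [integral_const_mul, integral_pow_mul_exp_neg_abs even_two, Nat.factorial_two]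
  push_cast
  ring

lemma ae_snd_ne {g : ℝ → ℝ} (hg : Measurable g) : ∀ᵐ p : ℝ × ℝ, p.2 ≠ g p.1 := by
  have hgraph : MeasurableSet {p : ℝ × ℝ | p.2 ≠ g p.1} :=
    (measurableSet_eq_fun measurable_snd (hg.comp measurable_fst)).compl
  rw [Measure.volume_eq_prod]
  exact (Measure.ae_prod_mem_iff_ae_ae_mem hgraph).2
    (Eventually.of_forall fun u => Measure.ae_ne volume (g u))

lemma tendsto_scaledKernel {p : ℝ × ℝ} (hp : p.1 ≠ 0) :
    Tendsto (fun a => scaledKernel a p) atTop (𝓝 (-p.2 / p.1 ^ 2 * Real.exp (-|p.1|))) := by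
  have hM : Tendsto (fun a : ℝ => p.1 ^ 2 + p.2 ^ 2 / a ^ 2) atTop (𝓝 (p.1 ^ 2)) := by
    simpa only [add_zero] using
      (tendsto_const_nhds.div_atTop (tendsto_pow_atTop two_ne_zero)).const_add (p.1 ^ 2)
  rw [← Real.sqrt_sq_eq_abs]
  exact (tendsto_const_nhds.div hM (pow_ne_zero 2 hp)).mul
    ((Real.continuous_exp.tendsto _).comp hM.sqrt.neg)

namespace IsGraphChart

variable {Ω U : Set Plane} {e : Plane ≃ₗᵢ[ℝ] Plane} {f : ℝ → ℝ} {y : Plane}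

lemma tendsto_scaledDefect (h : IsGraphChart Ω U e f) (hΩ : IsOpen Ω) (hy : y ∈ U)
    (hyΩ : y ∈ frontier Ω) {e' : Plane ≃ₗᵢ[ℝ] Plane}
    (he' : ∀ z, (e' z) 1 = inner ℝ (chartNormal e f y) z) {p : ℝ × ℝ} (hp : p.1 ≠ 0)
    (hgraph : p.2 ≠ graphCurvature f ((e y) 0) / 2 * p.1 ^ 2) :
    Tendsto (fun a => scaledDefect Ω y e' a p) atTop
      (𝓝 (limitDefect (graphCurvature f ((e y) 0)) p)) := by
  classical
  refine Tendsto.mul (tendsto_const_nhds.congr' ?_) (tendsto_scaledKernel hp)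
  filter_upwards [h.eventually_mem_parabolic_scaling hΩ hy hyΩ he' hgraph] with a ha
  simp only [Set.indicator_apply, ha, Set.mem_Iio, Pi.one_apply]

lemma tendsto_pow_four_mul_fluxDefect (h : IsGraphChart Ω U e f) (hΩ : IsOpen Ω) (hy : y ∈ U)
    (hyΩ : y ∈ frontier Ω) :
    Tendsto (fun a => a ^ 4 * fluxDefect Ω a (chartNormal e f y) y) atTop
      (𝓝 (curvature Ω y ^ 2 / 2)) := by
  have hn := norm_chartNormal e f y
  obtain ⟨e', he'⟩ := exists_isometry_apply_one_eq_inner hn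
  obtain ⟨C, hC, ht⟩ : ∃ C, 0 ≤ C ∧ IsParabolicTangent Ω y (chartNormal e f y) C := by
    obtain ⟨C, hC⟩ := h.exists_isParabolicTangent hΩ hy
    exact ⟨|C|, abs_nonneg C, (hC.self_of_nhds hyΩ).mono (le_abs_self C)⟩
  have hdominated := tendsto_integral_filter_of_dominated_convergence _
    (Eventually.of_forall fun a =>
      (measurable_scaledDefect hΩ.measurableSet y e' a).aestronglyMeasurable)
    ((eventually_gt_atTop (0 : ℝ)).mono fun a ha =>
      Eventually.of_forall (ht.abs_scaledDefect_le hC he' ha))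
    (integrable_defectMajorant C)
    (by
      filter_upwards [Measure.quasiMeasurePreserving_fst.ae (Measure.ae_ne volume (0 : ℝ)),
        ae_snd_ne (g := fun u => graphCurvature f ((e y) 0) / 2 * u ^ 2) (by fun_prop)]
        with p hp hgraph using h.tendsto_scaledDefect hΩ hy hyΩ he' hp hgraph)
  rw [integral_limitDefect, ← h.curvature_sq hΩ hy hyΩ] at hdominated
  refine hdominated.congr' ?_
  filter_upwards [eventually_gt_atTop 0] with a ha using
    (pow_four_mul_fluxDefect hΩ.measurableSet hn he' ha).symm

end IsGraphChart

/-! ### The energy -/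

lemma integrable_yukawa_sub {a : ℝ} (ha : 0 < a) (μ : Measure Plane) [IsFiniteMeasure μ] :
    Integrable (fun p : Plane × Plane => yukawa a (p.1 - p.2)) (volume.prod μ) := by
  simpa only [ContinuousLinearMap.mul_apply', one_mul] using
    (integrable_const (1 : ℝ)).convolution_integrand (ν := μ) (ContinuousLinearMap.mul ℝ ℝ)
      (integrable_yukawa ha)

lemma integrable_fluxKernel_sub {a : ℝ} (ha : 0 < a) {n : Plane → Plane} (hn : Measurable n)
    {C : ℝ} (hC : ∀ y, ‖n y‖ ≤ C) (μ : Measure Plane) [IsFiniteMeasure μ] :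
    Integrable (fun p : Plane × Plane => fluxKernel a (n p.2) (p.1 - p.2)) (volume.prod μ) := by
  refine (((integrable_yukawa_sub ha μ).div_const a).const_mul C).mono'
    ((measurable_fluxKernel a).comp ((hn.comp measurable_snd).prodMk
      (measurable_fst.sub measurable_snd))).aestronglyMeasurable (Eventually.of_forall fun p => ?_)
  have := yukawa_nonneg a (p.1 - p.2)
  refine (abs_fluxKernel_le ha (n p.2) (p.1 - p.2)).trans ?_
  gcongr
  exact hC p.2

namespace IsRegularSet

variable {Ω : Set Plane} {n : Plane → Plane} {a : ℝ}

lemma integrable_yukawa_prod (hΩ : IsRegularSet Ω) (ha : 0 < a) :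
    Integrable (fun p : Plane × Plane => yukawa a (p.1 - p.2))
      ((volume.restrict Ω).prod (volume.restrict Ωᶜ)) := by
  have : IsFiniteMeasure (volume.restrict Ω) :=
    isFiniteMeasure_restrict.2 hΩ.isBounded.measure_lt_top.ne
  refine ((integrable_yukawa_sub ha (volume.restrict Ω)).swap.congr
    (Eventually.of_forall fun p => ?_)).mono_measure
      (Measure.prod_mono le_rfl Measure.restrict_le_self)
  rw [Function.comp_apply, Prod.fst_swap, Prod.snd_swap, ← yukawa_neg, neg_sub]

lemma integrable_fluxKernel_prod (hΩ : IsRegularSet Ω) (hn : IsNormalField Ω n) (ha : 0 < a) :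
    Integrable (fun p : Plane × Plane => fluxKernel a (n p.2) (p.1 - p.2))
      ((volume.restrict Ω).prod (μH[1].restrict (frontier Ω))) :=
  have := hΩ.isFiniteMeasure_frontier
  (integrable_fluxKernel_sub ha hn.contDiff.continuous.measurable hn.norm_le_one _).mono_measure
    (Measure.prod_mono Measure.restrict_le_self le_rfl)

lemma integrableOn_fluxDefect (hΩ : IsRegularSet Ω) (hn : IsNormalField Ω n) (ha : 0 < a) :
    IntegrableOn (fun y => fluxDefect Ω a (n y) y) (frontier Ω) μH[1] :=
  have := hΩ.isFiniteMeasure_frontier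
  (integrable_const _).sub (hΩ.integrable_fluxKernel_prod hn ha).integral_prod_right

lemma integral_integral_yukawa (hΩ : IsRegularSet Ω) (hn : IsNormalField Ω n) (ha : 0 < a) :
    ∫ x in Ω, ∫ y in Ωᶜ, yukawa a (x - y) =
      2 / a ^ 2 * (perimeter Ω).toReal - ∫ y in frontier Ω, fluxDefect Ω a (n y) y ∂μH[1] := by
  have := hΩ.isFiniteMeasure_frontier
  calc ∫ x in Ω, ∫ y in Ωᶜ, yukawa a (x - y)
      = ∫ x in Ω, ∫ y in frontier Ω, fluxKernel a (n y) (x - y) ∂μH[1] :=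
        setIntegral_congr_fun hΩ.isOpen.measurableSet fun x hx =>
          hΩ.setIntegral_compl_yukawa hn ha hx
    _ = ∫ y in frontier Ω, (2 / a ^ 2 - fluxDefect Ω a (n y) y) ∂μH[1] := by
        rw [integral_integral_swap (hΩ.integrable_fluxKernel_prod hn ha)]
        simp only [fluxDefect, sub_sub_cancel]
    _ = 2 / a ^ 2 * (perimeter Ω).toReal -
          ∫ y in frontier Ω, fluxDefect Ω a (n y) y ∂μH[1] := by
        rw [integral_sub (integrable_const _) (hΩ.integrableOn_fluxDefect hn ha),
          setIntegral_const, hΩ.perimeter_eq, Measure.real, smul_eq_mul, mul_comm]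

lemma energy_eq (hΩ : IsRegularSet Ω) (hn : IsNormalField Ω n) {l α : ℝ} (hl : 0 < l)
    (hα : 0 < α) :
    energy l α Ω = (1 - 1 / (2 * Real.pi * α ^ 2)) * (perimeter Ω).toReal +
      l ^ 2 / (4 * Real.pi) * ∫ y in frontier Ω, fluxDefect Ω (l * α) (n y) y ∂μH[1] := by
  rw [energy, hΩ.integral_integral_yukawa hn (mul_pos hl hα)]
  field_simp
  ring

lemma tendsto_pow_four_mul_integral_fluxDefect (hΩ : IsRegularSet Ω) (hn : IsNormalField Ω n) :
    Tendsto (fun a => a ^ 4 * ∫ y in frontier Ω, fluxDefect Ω a (n y) y ∂μH[1]) atTop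
      (𝓝 ((∫ y in frontier Ω, curvature Ω y ^ 2 ∂μH[1]) / 2)) := by
  have := hΩ.isFiniteMeasure_frontier
  obtain ⟨C, hC, ht⟩ := hn.exists_isParabolicTangent hΩ
  have hmem : ∀ᵐ y ∂μH[1].restrict (frontier Ω), y ∈ frontier Ω :=
    ae_restrict_mem isClosed_frontier.measurableSet
  simp only [← integral_const_mul]
  rw [← integral_div]
  refine tendsto_integral_filter_of_dominated_convergence (fun _ => ∫ p, defectMajorant C p)
    ?_ ?_ (integrable_const _) ?_
  · filter_upwards [eventually_gt_atTop 0] with a ha using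
      ((hΩ.integrableOn_fluxDefect hn ha).const_mul _).aestronglyMeasurable
  · filter_upwards [eventually_gt_atTop 0] with a ha
    filter_upwards [hmem] with y hy using (ht y hy).abs_pow_four_mul_fluxDefect_le
      hΩ.isOpen.measurableSet (hn.norm_eq_one hΩ hy) hC ha
  · filter_upwards [hmem] with y hy
    obtain ⟨r, e, f, hr, h⟩ := hΩ.exists_isGraphChart hy
    rw [hn.eq_chartNormal hy h (Metric.mem_ball_self hr)]
    exact h.tendsto_pow_four_mul_fluxDefect hΩ.isOpen (Metric.mem_ball_self hr) hy

end IsRegularSet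

theorem proposition2p5 (α : ℝ) (hα : 0 < α) (Ω : Set Plane) (hΩ : IsRegularSet Ω) :
    perimeter Ω ≠ ⊤ ∧
    (∀ l : ℝ, 0 < l → Integrable (fun p : Plane × Plane => yukawa (l * α) (p.1 - p.2))
      ((volume.restrict Ω).prod (volume.restrict Ωᶜ))) ∧
    IntegrableOn (fun x => curvature Ω x ^ 2) (frontier Ω) (Measure.hausdorffMeasure 1) ∧
    (fun l : ℝ => energy l α Ω -
        ((1 - 1 / (2 * Real.pi * α ^ 2)) * (perimeter Ω).toReal +
          1 / (8 * Real.pi * α ^ 4 * l ^ 2) *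
            ∫ x in frontier Ω, curvature Ω x ^ 2 ∂(Measure.hausdorffMeasure 1)))
      =o[atTop] (fun l : ℝ => (l ^ 2)⁻¹) := by
  refine ⟨hΩ.perimeter_eq ▸ hΩ.hausdorffMeasure_frontier_lt_top.ne,
    fun l hl => hΩ.integrable_yukawa_prod (mul_pos hl hα), hΩ.integrableOn_curvature_sq, ?_⟩
  obtain ⟨n, hn⟩ := hΩ.exists_isNormalField
  set K := ∫ x in frontier Ω, curvature Ω x ^ 2 ∂μH[1]
  set D : ℝ → ℝ := fun a => ∫ y in frontier Ω, fluxDefect Ω a (n y) y ∂μH[1]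
  have hdefect : (fun l : ℝ => (l * α) ^ 4 * D (l * α) - K / 2) =o[atTop] fun _ => (1 : ℝ) :=
    (isLittleO_one_iff ℝ).2 <| tendsto_sub_nhds_zero_iff.2 <|
      (hΩ.tendsto_pow_four_mul_integral_fluxDefect hn).comp (tendsto_id.atTop_mul_const hα)
  refine ((hdefect.const_mul_left (1 / (4 * Real.pi * α ^ 4))).mul_isBigO
    (isBigO_refl (fun l : ℝ => (l ^ 2)⁻¹) atTop)).congr' ?_ (by simp)
  filter_upwards [eventually_gt_atTop 0] with l hl
  rw [hΩ.energy_eq hn hl hα]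
  field_simp
  ring
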